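/- Let $d\in\{2,3\}$, let $D\subset\mathbb{R}^d$ be a bounded domain, $Y=(0,1)^d$, let $Y_1,\dots,Y_n$ be copies of $Y$, $\mathbf{Y}=Y_1\times\dots\times Y_n$, $\mathbf{Y}_i=Y_1\times\dots\times Y_i$, and $T>0$. Let $b:D\times\mathbf{Y}\to\mathbb{R}^{d\times d}_{\rm sym}$ and $a$ ($\mathbb{R}^{3\times3}_{\rm sym}$-valued if $d=3$, scalar if $d=2$, where the curl is scalar) be measurable, and assume there are $\alpha,\beta>0$ with $\alpha|\xi|^2\le M\xi\cdot\xi$ and $M\xi\cdot\zeta\le\beta|\xi||\zeta|$ on $D\times\mathbf{Y}$ for $M=a,b$ and all $\xi,\zeta$. Put $H=L^2(D)^d$ and $H_i=L^2(D\times\mathbf{Y}_i)^d$ (for scalar curls, when $d=2$, the corresponding scalar $L^2$ spaces), let $W=H_0(\mathrm{curl},D)$ be the closure of the smooth fields compactly supported in $D$ in the graph norm of the curl, and let $$W_i=L^2(D\times\mathbf{Y}_{i-1},\tilde H_\#(\mathrm{curl},Y_i)),\qquad V_i=L^2(D\times\mathbf{Y}_{i-1},H^1_\#(Y_i)/\mathbb{R}),$$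 where $\#$ denotes periodicity with respect to the unit cube and $\tilde H_\#(\mathrm{curl},Y_i)$ is the space of classes of functions in $H_\#(\mathrm{curl},Y_i)$ with equal curl. Let $\mathbf{V}=W\times W_1\times\dots\times W_n\times V_1\times\dots\times V_n$ and, for $\boldsymbol v=(v_0,\{v_i\},\{\mathfrak v_i\})$ and $\boldsymbol w=(w_0,\{w_i\},\{\mathfrak w_i\})$ in $\mathbf V$, $$A(\boldsymbol v,\boldsymbol w)=\int_D\int_{\mathbf Y}a\Big(\mathrm{curl}\,v_0+\sum_i\mathrm{curl}_{y_i}v_i\Big)\cdot\Big(\mathrm{curl}\,w_0+\sum_i\mathrm{curl}_{y_i}w_i\Big)\,d\boldsymbol y\,dx,$$ $$B(\boldsymbol v,\boldsymbol w)=\int_D\int_{\mathbf Y}b\Big(v_0+\sum_i\nabla_{y_i}\mathfrak v_i\Big)\cdot\Big(w_0+\sum_i\nabla_{y_i}\mathfrak w_i\Big)\,d\boldsymbol y\,dx.$$ Let $f\in L^2(0,T;H)$, $g_0\in W$, $g_1\in H$. Let $\boldsymbol u=(u_0,\{u_i\},\{\mathfrak u_i\})$ be the solution of the multiscale homogenized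 Maxwell wave problem, and assume that $\frac{\partial^2\boldsymbol u}{\partial t^2}\in L^2(0,T;\mathbf V)$, i.e. $\boldsymbol u\in H^2(0,T;\mathbf V)$; thus, for every $\boldsymbol v\in\mathbf V$ and almost every $t\in(0,T)$, $$B\Big(\frac{\partial^2\boldsymbol u}{\partial t^2}(t),\boldsymbol v\Big)+A(\boldsymbol u(t),\boldsymbol v)=\int_Df(t)\cdot v_0\,dx,$$ with $u_0(0)=g_0$, $\nabla_{y_i}\mathfrak u_i(0)=0$ for $i=1,\dots,n$, and $B(\frac{\partial\boldsymbol u}{\partial t}(0),\boldsymbol v)=\int_D\int_{\mathbf Y}b\,g_1\cdot(v_0+\sum_i\nabla_{y_i}\mathfrak v_i)\,d\boldsymbol y\,dx$ for all $\boldsymbol v\in\mathbf V$. Let $W^1\subset W^2\subset\dots\subset W$, $W_i^1\subset W_i^2\subset\dots\subset W_i$ and $V_i^1\subset V_i^2\subset\dots\subset V_i$ ($i=1,\dots,n$) be nested sequences of finite-dimensional subspaces whose unions are dense in $W$, $W_i$ and $V_i$ respectively, and put $\mathbf V^L=W^L\times W_1^L\times\dots\times W_n^L\times V_1^L\times\dots\times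 V_n^L$. Let $g_0^L,g_1^L\in W^L$, and let $\boldsymbol u^L=(u_0^L,\{u_i^L\},\{\mathfrak u_i^L\})\in H^2(0,T;\mathbf V^L)$ be the semidiscrete solution: for every $\boldsymbol v^L=(v^L_0,\{v^L_i\},\{\mathfrak v^L_i\})\in\mathbf V^L$ and almost every $t\in(0,T)$, $$B\Big(\frac{\partial^2\boldsymbol u^L}{\partial t^2}(t),\boldsymbol v^L\Big)+A(\boldsymbol u^L(t),\boldsymbol v^L)=\int_Df(t)\cdot v_0^L\,dx,$$ with $u_0^L(0)=g_0^L$, $\nabla_{y_i}\mathfrak u_i^L(0)=0$, $\frac{\partial u_0^L}{\partial t}(0)=g_1^L$, $\frac{\partial}{\partial t}\nabla_{y_i}\mathfrak u_i^L(0)=0$. If $\lim_{L\to\infty}\|g_0^L-g_0\|_W=0$ and $\lim_{L\to\infty}\|g_1^L-g_1\|_H=0$, then $$\lim_{L\to\infty}\Big\{\Big\|\frac{\partial(u_0^L-u_0)}{\partial t}\Big\|_{L^\infty(0,T;H)}+\sum_{i=1}^n\Big\|\nabla_{y_i}\frac{\partial(\mathfrak u_i^L-\mathfrak u_i)}{\partial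 t}\Big\|_{L^\infty(0,T;H_i)}+\|\mathrm{curl}(u_0^L-u_0)\|_{L^\infty(0,T;H)}+\sum_{i=1}^n\|\mathrm{curl}_{y_i}(u_i^L-u_i)\|_{L^\infty(0,T;H_i)}\Big\}=0.$$ -/

import Mathlib

open MeasureTheory Filter Topology
open scoped ENNReal ContDiff

noncomputable section

namespace MaxwellWave

/-! ### Domains and points -/

/-- The Euclidean space `ℝ^m`. -/
abbrev E (m : ℕ) : Type := EuclideanSpace ℝ (Fin m)

/-- A bounded domain (bounded, connected, nonempty open set) in `ℝ^d`. -/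
structure BoundedDomain (d : ℕ) where
  carrier : Set (E d)
  isOpen' : IsOpen carrier
  isConnected' : IsConnected carrier
  isBounded' : Bornology.IsBounded carrier

/-- Points `(x, y_1, …, y_k)` with `x` and all `y_j` in `ℝ^d`. -/
abbrev Pt (d k : ℕ) : Type := E d × (Fin k → E d)

/-- The unit cube `Y` of `ℝ^d`. -/
def cell (d : ℕ) : Set (E d) := {y | ∀ j, y j ∈ Set.Ioo (0 : ℝ) 1}

variable {d : ℕ}

/-- The set `D × Y_1 × ⋯ × Y_k`. -/
def prodDomain (D : BoundedDomain d) (k : ℕ) : Set (Pt d k) :=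
  {p | p.1 ∈ D.carrier ∧ ∀ j, p.2 j ∈ cell d}

/-- Lebesgue measure on `D`. -/
abbrev volD (D : BoundedDomain d) : Measure (E d) := volume.restrict D.carrier

/-- Lebesgue measure on `D × Y_1 × ⋯ × Y_k`. -/
abbrev volDY (D : BoundedDomain d) (k : ℕ) : Measure (Pt d k) :=
  volume.restrict (prodDomain D k)

/-- `(x, y_1, …, y_{k+1}) ↦ (x, y_1, …, y_k)`. -/
def front {k : ℕ} (p : Pt d (k + 1)) : Pt d k := (p.1, fun j => p.2 j.castSucc)

/-- `(x, y_1, …, y_{k+1}) ↦ y_{k+1}`. -/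
def lastY {k : ℕ} (p : Pt d (k + 1)) : E d := p.2 (Fin.last k)

/-- `(x, y_1, …, y_n) ↦ (x, y_1, …, y_{i+1})`, for the zero-based index `i` of a scale. -/
def upTo {n : ℕ} (i : Fin n) (p : Pt d n) : Pt d (i + 1) :=
  (p.1, fun j => p.2 (Fin.castLE i.isLt j))

/-! ### The curl in dimensions two and three -/

/-- Number of components of the curl: it is a scalar for `d = 2`, a 3-vector for `d = 3`. -/
def curlDim : ℕ → ℕ
  | 2 => 1
  | 3 => 3
  | _ => 0

/-- The coefficients in `(curl φ)_c = ∑ j k, curlCoeff d c j k * ∂_j φ_k`. -/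
def curlCoeff : (d : ℕ) → Fin (curlDim d) → Fin d → Fin d → ℝ
  | 2 => fun _ j k => if j = 0 ∧ k = 1 then 1 else if j = 1 ∧ k = 0 then -1 else 0
  | 3 => fun (c : Fin 3) j k =>
      if j = c + 1 ∧ k = c + 2 then 1 else if j = c + 2 ∧ k = c + 1 then -1 else 0
  | 0 => fun _ _ _ => 0
  | 1 => fun _ _ _ => 0
  | _ + 4 => fun _ _ _ => 0

/-- The partial derivative `∂_j φ`. -/
def pd (j : Fin d) (φ : E d → ℝ) (y : E d) : ℝ := fderiv ℝ φ y (EuclideanSpace.single j 1)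

/-- The classical curl of a vector field. -/
def curl (φ : E d → E d) (x : E d) : E (curlDim d) :=
  WithLp.toLp 2 fun c => ∑ j, ∑ k, curlCoeff d c j k * pd j (fun z => φ z k) x

/-! ### The space `W = H₀(curl, D)` and the space `H = L²(D)^d` -/

/-- `H = L²(D)^d`. -/
abbrev HSpace (D : BoundedDomain d) : Type := Lp (E d) 2 (volD D)

/-- `W = H₀(curl, D)`: the closure in `H(curl, D)` of the smooth fields compactly supported in `D`
(vanishing tangential trace). An element `u` is stored as the pair `(u, curl u)`, with the
graph norm `(‖u‖² + ‖curl u‖²)^{1/2}`. -/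
def H0curl (D : BoundedDomain d) :
    Submodule ℝ (WithLp 2 (Lp (E d) 2 (volD D) × Lp (E (curlDim d)) 2 (volD D))) :=
  (Submodule.span ℝ {p | ∃ φ : E d → E d, ContDiff ℝ ∞ φ ∧ HasCompactSupport φ ∧
    tsupport φ ⊆ D.carrier ∧ p.fst =ᵐ[volD D] φ ∧ p.snd =ᵐ[volD D] curl φ}).topologicalClosure

/-- The space `W`. -/
abbrev WSpace (D : BoundedDomain d) : Type := H0curl D

/-- The inclusion `W ⊂ H`. -/
def incl {D : BoundedDomain d} (u : WSpace D) : HSpace D := u.1.fst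

/-- The curl of an element of `W`. -/
def curlX {D : BoundedDomain d} (u : WSpace D) : Lp (E (curlDim d)) 2 (volD D) := u.1.snd

/-! ### Functions on `D × Y_1 × ⋯ × Y_{k+1}` periodic in the last variable -/

/-- `L²(D × Y_1 × ⋯ × Y_k)^m`. -/
abbrev L2DY (D : BoundedDomain d) (k m : ℕ) : Type := Lp (E m) 2 (volDY D k)

/-- Smooth functions on `ℝ^d` periodic with respect to the unit cube. -/
def IsPeriodicTest (φ : E d → ℝ) : Prop :=
  ContDiff ℝ ∞ φ ∧ ∀ y j, φ (y + EuclideanSpace.single j 1) = φ y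

/-- Bounded measurable functions of the parameters `z = (x, y_1, …, y_k)`. -/
def IsParamTest {k : ℕ} (ψ : Pt d k → ℝ) : Prop :=
  Measurable ψ ∧ ∃ C, ∀ z, |ψ z| ≤ C

/-- `c` is the weak periodic curl of `w` in the last variable `y_{k+1}`: for almost every
`z = (x, y_1, …, y_k)`, `∫_Y c(z,y) φ(y) dy = - ∫_Y ∑ ε_{cjk} ∂_jφ(y) w_k(z,y) dy` for all smooth
periodic `φ`; the exceptional set is dealt with by testing against functions of `z`. -/
def IsWeakCurlY {D : BoundedDomain d} {k : ℕ} (w : L2DY D (k + 1) d)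
    (c : L2DY D (k + 1) (curlDim d)) : Prop :=
  ∀ (ψ : Pt d k → ℝ) (φ : E d → ℝ), IsParamTest ψ → IsPeriodicTest φ → ∀ m : Fin (curlDim d),
    ∫ p, ψ (front p) * φ (lastY p) * c p m ∂(volDY D (k + 1)) =
      -∑ j, ∑ l, curlCoeff d m j l *
        ∫ p, ψ (front p) * pd j φ (lastY p) * w p l ∂(volDY D (k + 1))

/-- `g` is the weak periodic gradient of the scalar function `v` in the last variable. -/
def IsWeakGradY {D : BoundedDomain d} {k : ℕ} (v : Lp ℝ 2 (volDY D (k + 1)))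
    (g : L2DY D (k + 1) d) : Prop :=
  ∀ (ψ : Pt d k → ℝ) (φ : E d → ℝ), IsParamTest ψ → IsPeriodicTest φ → ∀ m : Fin d,
    ∫ p, ψ (front p) * φ (lastY p) * g p m ∂(volDY D (k + 1)) =
      -∫ p, ψ (front p) * pd m φ (lastY p) * v p ∂(volDY D (k + 1))

/-! #### Helper facts: the two relations define closed subspaces -/

lemma cell_subset_Icc (d : ℕ) :
    cell d ⊆ (WithLp.ofLp : E d → (Fin d → ℝ)) ⁻¹' Set.Icc (fun _ => 0) (fun _ => 1) := by
  intro y hy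
  exact ⟨fun j => (hy j).1.le, fun j => (hy j).2.le⟩

lemma isCompact_Icc_cell (d : ℕ) :
    IsCompact ((WithLp.ofLp : E d → (Fin d → ℝ)) ⁻¹' Set.Icc (fun _ => 0) (fun _ => 1)) :=
  (EuclideanSpace.equiv (Fin d) ℝ).toHomeomorph.isClosedEmbedding.isCompact_preimage isCompact_Icc

lemma isOpen_cell (d : ℕ) : IsOpen (cell d) := by
  have : cell d = ⋂ j, (fun y : E d => y j) ⁻¹' Set.Ioo (0 : ℝ) 1 := by
    ext y; simp [cell]
  rw [this]
  exact isOpen_iInter_of_finite fun j => isOpen_Ioo.preimage (by fun_prop)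

lemma measurableSet_prodDomain (D : BoundedDomain d) (k : ℕ) :
    MeasurableSet (prodDomain D k) := by
  apply IsOpen.measurableSet
  have : prodDomain D k = D.carrier ×ˢ Set.pi Set.univ fun _ => cell d := by
    ext p; simp [prodDomain]
  rw [this]
  exact D.isOpen'.prod (isOpen_set_pi Set.finite_univ fun _ _ => isOpen_cell d)

instance (D : BoundedDomain d) (k : ℕ) : IsFiniteMeasure (volDY D k) := by
  refine ⟨?_⟩
  rw [Measure.restrict_apply_univ]
  have h : prodDomain D k ⊆ D.carrier ×ˢ Set.pi Set.univ fun _ => cell d := by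
    intro p hp; simpa [prodDomain] using hp
  refine lt_of_le_of_lt (measure_mono h) ?_
  have hb : Bornology.IsBounded (D.carrier ×ˢ Set.pi Set.univ fun _ : Fin k => cell d) :=
    D.isBounded'.prod (Bornology.IsBounded.pi fun _ =>
      (isCompact_Icc_cell d).isBounded.subset (cell_subset_Icc d))
  exact hb.measure_lt_top

lemma memLp_test {D : BoundedDomain d} {k : ℕ} {ψ : Pt d k → ℝ} {φ : E d → ℝ}
    (hψ : IsParamTest ψ) (hφ : Continuous φ) :
    MemLp (fun p : Pt d (k + 1) => ψ (front p) * φ (lastY p)) 2 (volDY D (k + 1)) := by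
  obtain ⟨hm, C, hC⟩ := hψ
  obtain ⟨K, hK⟩ := (isCompact_Icc_cell d).exists_bound_of_continuousOn hφ.continuousOn
  have hf : Measurable (front : Pt d (k + 1) → Pt d k) := by unfold front; fun_prop
  have hl : Measurable (lastY : Pt d (k + 1) → E d) := by unfold lastY; fun_prop
  refine MemLp.of_bound (((hm.comp hf).mul (hφ.measurable.comp hl)).aestronglyMeasurable)
    (C * K) ?_
  filter_upwards [ae_restrict_mem (measurableSet_prodDomain D (k + 1))] with p hp
  rw [norm_mul]
  exact mul_le_mul (hC _) (hK _ (cell_subset_Icc d (hp.2 _))) (norm_nonneg _)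
    ((abs_nonneg _).trans (hC (front p)))

/-- Testing a component of an `L²` function against an `L²` weight is a continuous functional. -/
lemma exists_functional {α F : Type*} [MeasurableSpace α] [NormedAddCommGroup F]
    [NormedSpace ℝ F] {μ : Measure α} (l : F →L[ℝ] ℝ) {g : α → ℝ} (hg : MemLp g 2 μ) :
    ∃ T : Lp F 2 μ →L[ℝ] ℝ, ∀ f : Lp F 2 μ, T f = ∫ a, g a * l (f a) ∂μ := by
  refine ⟨(innerSL ℝ (hg.toLp g)).comp (l.compLpL 2 μ), fun f => ?_⟩
  rw [ContinuousLinearMap.comp_apply, innerSL_apply_apply, L2.inner_def]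
  refine integral_congr_ae ?_
  filter_upwards [hg.coeFn_toLp, l.coeFn_compLpL f] with a h1 h2
  rw [h1, h2]
  simp [mul_comm]

lemma exists_functional_curl {D : BoundedDomain d} {k : ℕ} (ψ : Pt d k → ℝ) (φ : E d → ℝ)
    (hψ : IsParamTest ψ) (hφ : IsPeriodicTest φ) (m : Fin (curlDim d)) :
    ∃ T : WithLp 2 (L2DY D (k + 1) d × L2DY D (k + 1) (curlDim d)) →L[ℝ] ℝ, ∀ q, T q = 0 ↔
      ∫ p, ψ (front p) * φ (lastY p) * q.snd p m ∂(volDY D (k + 1)) =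
        -∑ j, ∑ l, curlCoeff d m j l *
          ∫ p, ψ (front p) * pd j φ (lastY p) * q.fst p l ∂(volDY D (k + 1)) := by
  have hpd : ∀ j, Continuous (pd j φ) := fun j =>
    (hφ.1.continuous_fderiv (by simp)).clm_apply continuous_const
  obtain ⟨T₀, hT₀⟩ := exists_functional (EuclideanSpace.proj (𝕜 := ℝ) m)
    (memLp_test (D := D) hψ hφ.1.continuous)
  choose T hT using fun (j l : Fin d) => exists_functional
    (EuclideanSpace.proj l : E d →L[ℝ] ℝ) (memLp_test (D := D) hψ (hpd j))
  refine ⟨T₀.comp (WithLp.sndL 2 ℝ _ _) +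
    (∑ j, ∑ l, curlCoeff d m j l • T j l).comp (WithLp.fstL 2 ℝ _ _), fun q => ?_⟩
  rw [← add_eq_zero_iff_eq_neg]
  simp only [PiLp.proj_apply] at hT hT₀
  simp [hT, hT₀]

lemma exists_functional_grad {D : BoundedDomain d} {k : ℕ} (ψ : Pt d k → ℝ) (φ : E d → ℝ)
    (hψ : IsParamTest ψ) (hφ : IsPeriodicTest φ) (m : Fin d) :
    ∃ T : WithLp 2 (Lp ℝ 2 (volDY D (k + 1)) × L2DY D (k + 1) d) →L[ℝ] ℝ, ∀ q, T q = 0 ↔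
      ∫ p, ψ (front p) * φ (lastY p) * q.snd p m ∂(volDY D (k + 1)) =
        -∫ p, ψ (front p) * pd m φ (lastY p) * q.fst p ∂(volDY D (k + 1)) := by
  have hpd : Continuous (pd m φ) :=
    (hφ.1.continuous_fderiv (by simp)).clm_apply continuous_const
  obtain ⟨T₀, hT₀⟩ := exists_functional (EuclideanSpace.proj (𝕜 := ℝ) m)
    (memLp_test (D := D) hψ hφ.1.continuous)
  obtain ⟨T₁, hT₁⟩ := exists_functional (ContinuousLinearMap.id ℝ ℝ)
    (memLp_test (D := D) hψ hpd)
  refine ⟨T₀.comp (WithLp.sndL 2 ℝ _ _) + T₁.comp (WithLp.fstL 2 ℝ _ _), fun q => ?_⟩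
  rw [← add_eq_zero_iff_eq_neg]
  simp only [PiLp.proj_apply, ContinuousLinearMap.id_apply] at hT₁ hT₀
  simp [hT₁, hT₀]

/-! #### The spaces `W_i` and `V_i` -/

/-- `L²(D × Y_1 × ⋯ × Y_k, H_#(curl, Y_{k+1}))`, an element being stored as the pair
`(w, curl_{y_{k+1}} w)`, with the graph norm. -/
def HcurlPer (D : BoundedDomain d) (k : ℕ) :
    Submodule ℝ (WithLp 2 (L2DY D (k + 1) d × L2DY D (k + 1) (curlDim d))) where
  carrier := {q | IsWeakCurlY q.fst q.snd}
  zero_mem' := by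
    intro ψ φ hψ hφ m
    obtain ⟨T, hT⟩ := exists_functional_curl (D := D) ψ φ hψ hφ m
    exact (hT 0).1 (map_zero T)
  add_mem' := by
    intro p q hp hq ψ φ hψ hφ m
    obtain ⟨T, hT⟩ := exists_functional_curl (D := D) ψ φ hψ hφ m
    refine (hT _).1 ?_
    rw [map_add, (hT p).2 (hp ψ φ hψ hφ m), (hT q).2 (hq ψ φ hψ hφ m), add_zero]
  smul_mem' := by
    intro r p hp ψ φ hψ hφ m
    obtain ⟨T, hT⟩ := exists_functional_curl (D := D) ψ φ hψ hφ m
    refine (hT _).1 ?_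
    rw [map_smul, (hT p).2 (hp ψ φ hψ hφ m), smul_zero]

/-- `L²(D × Y_1 × ⋯ × Y_k, H¹_#(Y_{k+1}))`, an element being stored as the pair
`(v, ∇_{y_{k+1}} v)`, with the graph norm. -/
def H1Per (D : BoundedDomain d) (k : ℕ) :
    Submodule ℝ (WithLp 2 (Lp ℝ 2 (volDY D (k + 1)) × L2DY D (k + 1) d)) where
  carrier := {q | IsWeakGradY q.fst q.snd}
  zero_mem' := by
    intro ψ φ hψ hφ m
    obtain ⟨T, hT⟩ := exists_functional_grad (D := D) ψ φ hψ hφ m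
    exact (hT 0).1 (map_zero T)
  add_mem' := by
    intro p q hp hq ψ φ hψ hφ m
    obtain ⟨T, hT⟩ := exists_functional_grad (D := D) ψ φ hψ hφ m
    refine (hT _).1 ?_
    rw [map_add, (hT p).2 (hp ψ φ hψ hφ m), (hT q).2 (hq ψ φ hψ hφ m), add_zero]
  smul_mem' := by
    intro r p hp ψ φ hψ hφ m
    obtain ⟨T, hT⟩ := exists_functional_grad (D := D) ψ φ hψ hφ m
    refine (hT _).1 ?_
    rw [map_smul, (hT p).2 (hp ψ φ hψ hφ m), smul_zero]

lemma isClosed_HcurlPer (D : BoundedDomain d) (k : ℕ) :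
    IsClosed (HcurlPer D k : Set (WithLp 2 (L2DY D (k + 1) d × L2DY D (k + 1) (curlDim d)))) := by
  have h : (HcurlPer D k : Set (WithLp 2 (L2DY D (k + 1) d × L2DY D (k + 1) (curlDim d)))) = {q | IsWeakCurlY q.fst q.snd} := rfl
  simp only [h, IsWeakCurlY, Set.ofPred_forall]
  refine isClosed_iInter fun ψ => isClosed_iInter fun φ => isClosed_iInter fun hψ =>
    isClosed_iInter fun hφ => isClosed_iInter fun m => ?_
  obtain ⟨T, hT⟩ := exists_functional_curl (D := D) ψ φ hψ hφ m
  simp only [← hT]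
  exact isClosed_eq T.continuous continuous_const

lemma isClosed_H1Per (D : BoundedDomain d) (k : ℕ) :
    IsClosed (H1Per D k : Set (WithLp 2 (Lp ℝ 2 (volDY D (k + 1)) × L2DY D (k + 1) d))) := by
  have h : (H1Per D k : Set (WithLp 2 (Lp ℝ 2 (volDY D (k + 1)) × L2DY D (k + 1) d))) = {q | IsWeakGradY q.fst q.snd} := rfl
  simp only [h, IsWeakGradY, Set.ofPred_forall]
  refine isClosed_iInter fun ψ => isClosed_iInter fun φ => isClosed_iInter fun hψ =>
    isClosed_iInter fun hφ => isClosed_iInter fun m => ?_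
  obtain ⟨T, hT⟩ := exists_functional_grad (D := D) ψ φ hψ hφ m
  simp only [← hT]
  exact isClosed_eq T.continuous continuous_const

instance (D : BoundedDomain d) : CompleteSpace (H0curl D) :=
  (Submodule.isClosed_topologicalClosure _).completeSpace_coe

instance (D : BoundedDomain d) (k : ℕ) : CompleteSpace (HcurlPer D k) :=
  (isClosed_HcurlPer D k).completeSpace_coe

instance (D : BoundedDomain d) (k : ℕ) : CompleteSpace (H1Per D k) :=
  (isClosed_H1Per D k).completeSpace_coe

/-- `(w, curl_y w) ↦ curl_y w` on `L²(D × ⋯ × Y_k, H_#(curl, Y_{k+1}))`. -/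
def curlPerL (D : BoundedDomain d) (k : ℕ) :
    HcurlPer D k →L[ℝ] L2DY D (k + 1) (curlDim d) :=
  (WithLp.sndL 2 ℝ _ _).comp (HcurlPer D k).subtypeL

/-- `(v, ∇_y v) ↦ ∇_y v` on `L²(D × ⋯ × Y_k, H¹_#(Y_{k+1}))`. -/
def gradPerL (D : BoundedDomain d) (k : ℕ) : H1Per D k →L[ℝ] L2DY D (k + 1) d :=
  (WithLp.sndL 2 ℝ _ _).comp (H1Per D k).subtypeL

/-- The elements of vanishing `y_{k+1}`-curl. -/
def curlFree (D : BoundedDomain d) (k : ℕ) : Submodule ℝ (HcurlPer D k) :=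
  LinearMap.ker (curlPerL D k).toLinearMap

/-- The elements that do not depend on `y_{k+1}`. -/
def constY (D : BoundedDomain d) (k : ℕ) : Submodule ℝ (H1Per D k) :=
  LinearMap.ker (gradPerL D k).toLinearMap

instance (D : BoundedDomain d) (k : ℕ) : IsClosed (curlFree D k : Set (HcurlPer D k)) :=
  (curlPerL D k).isClosed_ker

instance (D : BoundedDomain d) (k : ℕ) : IsClosed (constY D k : Set (H1Per D k)) :=
  (gradPerL D k).isClosed_ker

/-- `W_{k+1} = L²(D × Y_1 × ⋯ × Y_k, H̃_#(curl, Y_{k+1}))`: classes of functions of equal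
`y_{k+1}`-curl, with the quotient norm. -/
def WPer (D : BoundedDomain d) (k : ℕ) : Type := HcurlPer D k ⧸ curlFree D k

/-- `V_{k+1} = L²(D × Y_1 × ⋯ × Y_k, H¹_#(Y_{k+1}) / ℝ)`, with the quotient norm. -/
def VPer (D : BoundedDomain d) (k : ℕ) : Type := H1Per D k ⧸ constY D k

instance (D : BoundedDomain d) (k : ℕ) : NormedAddCommGroup (WPer D k) :=
  Submodule.Quotient.normedAddCommGroup (curlFree D k)

instance (D : BoundedDomain d) (k : ℕ) : NormedSpace ℝ (WPer D k) :=
  Submodule.Quotient.normedSpace (curlFree D k) ℝ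

instance (D : BoundedDomain d) (k : ℕ) : CompleteSpace (WPer D k) :=
  Submodule.Quotient.completeSpace (curlFree D k)

instance (D : BoundedDomain d) (k : ℕ) : NormedAddCommGroup (VPer D k) :=
  Submodule.Quotient.normedAddCommGroup (constY D k)

instance (D : BoundedDomain d) (k : ℕ) : NormedSpace ℝ (VPer D k) :=
  Submodule.Quotient.normedSpace (constY D k) ℝ

instance (D : BoundedDomain d) (k : ℕ) : CompleteSpace (VPer D k) :=
  Submodule.Quotient.completeSpace (constY D k)

/-- The class in `W_{k+1}` of a function. -/
def WPer.mk {D : BoundedDomain d} {k : ℕ} : HcurlPer D k →ₗ[ℝ] WPer D k :=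
  (curlFree D k).mkQ

/-- The class in `V_{k+1}` of a function. -/
def VPer.mk {D : BoundedDomain d} {k : ℕ} : H1Per D k →ₗ[ℝ] VPer D k :=
  (constY D k).mkQ

/-- `curl_{y_{k+1}}` on `W_{k+1}`. -/
def curlY {D : BoundedDomain d} {k : ℕ} : WPer D k →ₗ[ℝ] L2DY D (k + 1) (curlDim d) :=
  (curlFree D k).liftQ (curlPerL D k).toLinearMap le_rfl

/-- `∇_{y_{k+1}}` on `V_{k+1}`. -/
def gradY {D : BoundedDomain d} {k : ℕ} : VPer D k →ₗ[ℝ] L2DY D (k + 1) d :=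
  (constY D k).liftQ (gradPerL D k).toLinearMap le_rfl

/-! ### The product space and the bilinear forms -/

/-- `𝐕 = W × W_1 × ⋯ × W_n × V_1 × ⋯ × V_n`; the scales are indexed by `i : Fin n`, so that the
zero-based index `i` stands for the `(i+1)`-st scale. (The product carries the maximum norm, which
is equivalent to the sum of the norms of the components.) -/
abbrev VSpace (D : BoundedDomain d) (n : ℕ) : Type :=
  WSpace D × (∀ i : Fin n, WPer D i) × (∀ i : Fin n, VPer D i)

variable {D : BoundedDomain d} {n : ℕ}

/-- The component `v_0 ∈ W`. -/
def VSpace.macro₀ (v : VSpace D n) : WSpace D := v.1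

/-- The component `v_i ∈ W_i`. -/
def VSpace.curlPart (v : VSpace D n) (i : Fin n) : WPer D i := v.2.1 i

/-- The component `𝔳_i ∈ V_i`. -/
def VSpace.gradPart (v : VSpace D n) (i : Fin n) : VPer D i := v.2.2 i

/-- `v_0(x) + ∑_i ∇_{y_i} 𝔳_i(x, y_1, …, y_i)` as a function on `D × 𝐘`. -/
def totalField (v : VSpace D n) (p : Pt d n) : E d :=
  incl v.macro₀ p.1 + ∑ i, gradY (v.gradPart i) (upTo i p)

/-- `curl v_0(x) + ∑_i curl_{y_i} v_i(x, y_1, …, y_i)` as a function on `D × 𝐘`. -/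
def totalCurl (v : VSpace D n) (p : Pt d n) : E (curlDim d) :=
  curlX v.macro₀ p.1 + ∑ i, curlY (v.curlPart i) (upTo i p)

/-- `M_{ij} ξ_i ζ_j`. -/
def mform {m : ℕ} (M : Matrix (Fin m) (Fin m) ℝ) (ξ ζ : E m) : ℝ :=
  ∑ i, ∑ j, M i j * ξ i * ζ j

/-- `∫_D ∫_𝐘 M F · G dy dx`. -/
def weighted {m : ℕ} (D : BoundedDomain d) (M : Pt d n → Matrix (Fin m) (Fin m) ℝ)
    (F G : Pt d n → E m) : ℝ :=
  ∫ p, mform (M p) (F p) (G p) ∂(volDY D n)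

/-- The bilinear form `A(v, w)`. -/
def formA (a : Pt d n → Matrix (Fin (curlDim d)) (Fin (curlDim d)) ℝ) (v w : VSpace D n) : ℝ :=
  weighted D a (totalCurl v) (totalCurl w)

/-- The bilinear form `B(v, w)`. -/
def formB (b : Pt d n → Matrix (Fin d) (Fin d) ℝ) (v w : VSpace D n) : ℝ :=
  weighted D b (totalField v) (totalField w)

/-- Measurable symmetric coefficients on `D × 𝐘`, bounded by `β` and coercive with constant `α`. -/
structure IsCoefficient {m : ℕ} (D : BoundedDomain d) (α β : ℝ)
    (M : Pt d n → Matrix (Fin m) (Fin m) ℝ) : Prop where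
  measurable : ∀ i j, AEMeasurable (fun p => M p i j) (volDY D n)
  symm : ∀ p ∈ prodDomain D n, (M p).IsSymm
  coercive : ∀ p ∈ prodDomain D n, ∀ ξ : E m, α * ‖ξ‖ ^ 2 ≤ mform (M p) ξ ξ
  bounded : ∀ p ∈ prodDomain D n, ∀ ξ ζ : E m, mform (M p) ξ ζ ≤ β * ‖ξ‖ * ‖ζ‖

/-! ### Time dependence, the homogenized problem and its semidiscretization -/

/-- Lebesgue measure on the time interval `(0, T)`. -/
abbrev volT (T : ℝ) : Measure ℝ := volume.restrict (Set.Ioo 0 T)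

/-- `u ∈ H²(0,T;X)`, i.e. `∂²u/∂t² ∈ L²(0,T;X)`, with first and second time derivatives `u'` and
`u''`; `u` and `u'` are the continuous representatives on `[0, T]`. -/
structure IsH2InTime {X : Type*} [NormedAddCommGroup X] [NormedSpace ℝ X] [CompleteSpace X]
    (T : ℝ) (u u' u'' : ℝ → X) : Prop where
  memLp : MemLp u'' 2 (volT T)
  deriv_eq : ∀ t ∈ Set.Icc 0 T, u' t = u' 0 + ∫ s in (0 : ℝ)..t, u'' s
  primitive_eq : ∀ t ∈ Set.Icc 0 T, u t = u 0 + ∫ s in (0 : ℝ)..t, u' s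

/-- `u`, with time derivatives `u'` and `u''` in `𝐕`, solves the multiscale homogenized Maxwell wave
equation with its initial conditions. -/
structure IsHomogenizedSolution (T : ℝ)
    (a : Pt d n → Matrix (Fin (curlDim d)) (Fin (curlDim d)) ℝ)
    (b : Pt d n → Matrix (Fin d) (Fin d) ℝ) (f : ℝ → HSpace D) (g₀ : WSpace D) (g₁ : HSpace D)
    (u u' u'' : ℝ → VSpace D n) : Prop where
  equation : ∀ v : VSpace D n, ∀ᵐ t ∂(volT T),
    formB b (u'' t) v + formA a (u t) v = inner ℝ (f t) (incl v.macro₀)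
  init_macro : (u 0).macro₀ = g₀
  init_grad : ∀ i, gradY ((u 0).gradPart i) = 0
  init_deriv : ∀ v : VSpace D n,
    formB b (u' 0) v = weighted D b (fun p => g₁ p.1) (totalField v)

/-- The product subspace `𝐕^L = W^L × W_1^L × ⋯ × W_n^L × V_1^L × ⋯ × V_n^L`. -/
def productSubspace (S₀ : Submodule ℝ (WSpace D)) (S : ∀ i : Fin n, Submodule ℝ (WPer D i))
    (R : ∀ i : Fin n, Submodule ℝ (VPer D i)) : Submodule ℝ (VSpace D n) :=
  S₀.prod ((Submodule.pi Set.univ S).prod (Submodule.pi Set.univ R))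

/-- `u ∈ H²(0,T;𝐕^L)` solves the spatially semidiscrete problem in the subspace `VL`, with the
initial data `g₀` and `g₁`. -/
structure IsSemidiscreteSolution (T : ℝ)
    (a : Pt d n → Matrix (Fin (curlDim d)) (Fin (curlDim d)) ℝ)
    (b : Pt d n → Matrix (Fin d) (Fin d) ℝ) (f : ℝ → HSpace D) (g₀ g₁ : WSpace D)
    (VL : Submodule ℝ (VSpace D n)) (u u' u'' : ℝ → VSpace D n) : Prop where
  mem : ∀ t ∈ Set.Icc 0 T, u t ∈ VL
  regular : IsH2InTime T u u' u''
  equation : ∀ v ∈ VL, ∀ᵐ t ∂(volT T),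
    formB b (u'' t) v + formA a (u t) v = inner ℝ (f t) (incl v.macro₀)
  init_macro : (u 0).macro₀ = g₀
  init_grad : ∀ i, gradY ((u 0).gradPart i) = 0
  init_deriv_macro : (u' 0).macro₀ = g₁
  init_deriv_grad : ∀ i, gradY ((u' 0).gradPart i) = 0

/-- A nested sequence of finite-dimensional subspaces whose union is dense. -/
structure IsApproximatingHierarchy {X : Type*} [NormedAddCommGroup X] [NormedSpace ℝ X]
    (S : ℕ → Submodule ℝ X) : Prop where
  nested : Monotone S
  finite : ∀ L, FiniteDimensional ℝ (S L)
  dense : Dense (⋃ L, (S L : Set X))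

end MaxwellWave

end

open MaxwellWave

/-! The forms B and A are pull-backs, under the bounded operators `fieldL` (total field) and `curlL`
(total curl), of bounded symmetric coercive forms on `L²(D × 𝐘)`. A weak periodic gradient or curl
has zero mean in its last variable, and coarser terms do not depend on that variable; the scales are
therefore mutually orthogonal (`norm_sq_multiscale`), and every norm in the conclusion is bounded by
that of a total field or a total curl. It suffices that `fieldL` of the velocity error and `curlL`
of the error tend to zero uniformly in time.

The comparison is made in the product of two `L²` spaces, a Hilbert space, through the map `(fieldL,
curlL)`. Let ρ be the error of the orthogonal projection of the image of u onto the image of `𝐕^L`.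
The projection is a fixed bounded operator, so it commutes with time derivatives, and density with
dominated convergence sends ρ(0), ρ'(0) and the time integral of the norm of ρ'' to zero
(`tendsto_projection_error`). The discrete part e of the error lies in the image of `𝐕^L`. Testing
the difference of the two equations with e' leaves the right-hand side B(ρ'', e') + A(ρ, e'). The
energy does not control the curl of e', so the last term is integrated by parts in time
(`energy_estimate`).

It remains to treat time zero. The continuous initial velocity field is g₁, because g₁ is a limit in
H of elements of W (`fieldL_init_deriv`). The microscopic curls are not prescribed, but test
functions with only microscopic curl components kill B and f; by continuity a stationary problem
holds at time zero, and Céa's argument gives convergence (`tendsto_curlL_init`). -/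

namespace MaxwellWave

/-! ### Calculus of functions of time with values in a Banach space. -/

section Time

variable {X Y : Type*} [NormedAddCommGroup X] [NormedSpace ℝ X] [CompleteSpace X]
  [NormedAddCommGroup Y] [NormedSpace ℝ Y] [CompleteSpace Y]

/-- The sums in the definition of absolute continuity are compared term by term. This serves to
transfer the property from a scalar primitive to a product of vector-valued ones. -/
lemma absolutelyContinuous_of_dist_le {Z₁ Z₂ : Type*} [PseudoMetricSpace Z₁]
    [PseudoMetricSpace Z₂] {h : ℝ → Z₁} {k : ℝ → Z₂} {a b : ℝ}
    (hk : AbsolutelyContinuousOnInterval k a b)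
    (hle : ∀ s ∈ Set.uIcc a b, ∀ t ∈ Set.uIcc a b, dist (h s) (h t) ≤ dist (k s) (k t)) :
    AbsolutelyContinuousOnInterval h a b := by
  rw [absolutelyContinuousOnInterval_iff] at hk ⊢
  intro ε hε
  obtain ⟨δ, hδ, H⟩ := hk ε hε
  refine ⟨δ, hδ, fun E hE hs => lt_of_le_of_lt (Finset.sum_le_sum fun i hi => ?_) (H E hE hs)⟩
  exact hle _ (hE.1 i hi).1 _ (hE.1 i hi).2

omit [CompleteSpace X] in
lemma dist_primitive_le {F : ℝ → X} {a b : ℝ} (hF : IntervalIntegrable F volume a b) (x₀ : X)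
    {s t : ℝ} (hs : s ∈ Set.uIcc a b) (ht : t ∈ Set.uIcc a b) :
    dist (x₀ + ∫ r in a..s, F r) (x₀ + ∫ r in a..t, F r) ≤
      dist (∫ r in a..s, ‖F r‖) (∫ r in a..t, ‖F r‖) := by
  have h1 : IntervalIntegrable F volume a s := hF.mono_set (Set.uIcc_subset_uIcc_left hs)
  have h2 : IntervalIntegrable F volume a t := hF.mono_set (Set.uIcc_subset_uIcc_left ht)
  rw [dist_add_left, dist_eq_norm, dist_eq_norm, intervalIntegral.integral_interval_sub_left h1 h2,
    intervalIntegral.integral_interval_sub_left h1.norm h2.norm]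
  exact intervalIntegral.norm_integral_le_abs_integral_norm

/-- Product rule for primitives of integrable functions under a bounded bilinear form. -/
theorem bilin_primitive (C : X →L[ℝ] Y →L[ℝ] ℝ) {F : ℝ → X} {G : ℝ → Y} {a b : ℝ}
    (hF : IntervalIntegrable F volume a b) (hG : IntervalIntegrable G volume a b) (x₀ : X)
    (y₀ : Y) :
    C (x₀ + ∫ r in a..b, F r) (y₀ + ∫ r in a..b, G r) = C x₀ y₀ +
      ∫ s in a..b, (C (F s) (y₀ + ∫ r in a..s, G r) + C (x₀ + ∫ r in a..s, F r) (G s)) := by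
  set f : ℝ → X := fun t => x₀ + ∫ r in a..t, F r with hf
  set g : ℝ → Y := fun t => y₀ + ∫ r in a..t, G r with hg
  have cf : ContinuousOn f (Set.uIcc a b) :=
    continuousOn_const.add (intervalIntegral.continuousOn_primitive_interval' hF Set.left_mem_uIcc)
  have cg : ContinuousOn g (Set.uIcc a b) :=
    continuousOn_const.add (intervalIntegral.continuousOn_primitive_interval' hG Set.left_mem_uIcc)
  obtain ⟨Mf, hMf⟩ := isCompact_uIcc.exists_bound_of_continuousOn cf
  obtain ⟨Mg, hMg⟩ := isCompact_uIcc.exists_bound_of_continuousOn cg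
  have hMf0 : 0 ≤ Mf := (norm_nonneg _).trans (hMf a Set.left_mem_uIcc)
  have hMg0 : 0 ≤ Mg := (norm_nonneg _).trans (hMg a Set.left_mem_uIcc)
  have hI : IntervalIntegrable (fun r => ‖C‖ * Mg * ‖F r‖ + ‖C‖ * Mf * ‖G r‖) volume a b :=
    (hF.norm.const_mul _).add (hG.norm.const_mul _)
  -- Only the scalar function `C (f t) (g t)` has to be absolutely continuous for the fundamental
  -- theorem of calculus. Its increments are dominated by those of the primitive of the integrand in
  -- `hI`.
  have hac : AbsolutelyContinuousOnInterval (fun t => C (f t) (g t)) a b := by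
    refine absolutelyContinuous_of_dist_le
      (hI.absolutelyContinuousOnInterval_intervalIntegral (c := a) Set.left_mem_uIcc) ?_
    intro s hs t ht
    have hd := dist_primitive_le hF x₀ hs ht
    have hd' := dist_primitive_le hG y₀ hs ht
    have i1 := hF.norm.mono_set (Set.uIcc_subset_uIcc_left hs)
    have i2 := hF.norm.mono_set (Set.uIcc_subset_uIcc_left ht)
    have j1 := hG.norm.mono_set (Set.uIcc_subset_uIcc_left hs)
    have j2 := hG.norm.mono_set (Set.uIcc_subset_uIcc_left ht)
    have e1 : C (f s) (g s) - C (f t) (g t) = C (f s - f t) (g s) + C (f t) (g s - g t) := by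
      simp only [map_sub, sub_apply]; ring
    have b1 : ‖C (f s - f t) (g s)‖ ≤ ‖C‖ * Mg * dist (f s) (f t) := by
      rw [dist_eq_norm]
      calc _ ≤ ‖C‖ * ‖f s - f t‖ * ‖g s‖ := C.le_opNorm₂ _ _
        _ ≤ ‖C‖ * ‖f s - f t‖ * Mg := by gcongr; exact hMg s hs
        _ = _ := by ring
    have b2 : ‖C (f t) (g s - g t)‖ ≤ ‖C‖ * Mf * dist (g s) (g t) := by
      rw [dist_eq_norm]
      calc _ ≤ ‖C‖ * ‖f t‖ * ‖g s - g t‖ := C.le_opNorm₂ _ _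
        _ ≤ ‖C‖ * Mf * ‖g s - g t‖ := by gcongr; exact hMf t ht
    calc dist (C (f s) (g s)) (C (f t) (g t)) ≤
        ‖C‖ * Mg * dist (f s) (f t) + ‖C‖ * Mf * dist (g s) (g t) := by
          rw [dist_eq_norm, e1]; exact (norm_add_le _ _).trans (add_le_add b1 b2)
      _ ≤ ‖C‖ * Mg * dist (∫ r in a..s, ‖F r‖) (∫ r in a..t, ‖F r‖) +
          ‖C‖ * Mf * dist (∫ r in a..s, ‖G r‖) (∫ r in a..t, ‖G r‖) := by
          gcongr
      _ = _ := by
          rw [intervalIntegral.integral_add (i1.const_mul _) (j1.const_mul _),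
            intervalIntegral.integral_add (i2.const_mul _) (j2.const_mul _)]
          simp only [intervalIntegral.integral_const_mul, Real.dist_eq]
          rw [intervalIntegral.integral_interval_sub_left i1 i2,
            intervalIntegral.integral_interval_sub_left j1 j2]
          have k1 := intervalIntegral.integral_interval_sub_left i1 i2
          have k2 := intervalIntegral.integral_interval_sub_left j1 j2
          rw [show ∀ p q r s k l : ℝ, k * p + l * q - (k * r + l * s) = k * (p - r) + l * (q - s)
            from fun p q r s k l => by ring, k1, k2]
          -- The integrals of `‖F‖` and `‖G‖` from `t` to `s` have the same sign, so absolute values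
          -- add without loss.
          rcases le_total t s with h | h
          · have p1 : 0 ≤ ∫ r in t..s, ‖F r‖ :=
              intervalIntegral.integral_nonneg h fun _ _ => norm_nonneg _
            have p2 : 0 ≤ ∫ r in t..s, ‖G r‖ :=
              intervalIntegral.integral_nonneg h fun _ _ => norm_nonneg _
            rw [abs_of_nonneg p1, abs_of_nonneg p2, abs_of_nonneg (by positivity)]
          · have p1 : 0 ≤ ∫ r in s..t, ‖F r‖ :=
              intervalIntegral.integral_nonneg h fun _ _ => norm_nonneg _
            have p2 : 0 ≤ ∫ r in s..t, ‖G r‖ :=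
              intervalIntegral.integral_nonneg h fun _ _ => norm_nonneg _
            rw [intervalIntegral.integral_symm s t, intervalIntegral.integral_symm s t,
              abs_neg, abs_neg, abs_of_nonneg p1, abs_of_nonneg p2, mul_neg, mul_neg, ← neg_add,
              abs_neg, abs_of_nonneg (by positivity)]
  have hFTC := hac.integral_deriv_eq_sub
  have h0 : C (f a) (g a) = C x₀ y₀ := by simp [hf, hg]
  rw [h0] at hFTC
  have : C (f b) (g b) = C x₀ y₀ + ∫ x in a..b, deriv (fun t => C (f t) (g t)) x := by
    rw [hFTC]; ring
  refine this.trans ?_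
  congr 1
  refine intervalIntegral.integral_congr_ae ?_
  -- By Lebesgue differentiation both primitives are differentiable almost everywhere, which is
  -- enough for the pointwise product rule under the integral.
  filter_upwards [hF.ae_hasDerivAt_integral, hG.ae_hasDerivAt_integral] with x h1 h2 hx
  have hx' := Set.uIoc_subset_uIcc hx
  have d1 : HasDerivAt f (F x) x := (h1 hx' a Set.left_mem_uIcc).const_add x₀
  have d2 : HasDerivAt g (G x) x := (h2 hx' a Set.left_mem_uIcc).const_add y₀
  have := (C.isBoundedBilinearMap.hasFDerivAt (f x, g x)).comp_hasDerivAt x (d1.prodMk d2)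
  rw [add_comm (C (F x) _)]
  exact this.deriv

variable {T : ℝ}

omit [CompleteSpace X] in
lemma continuousOn_of_eq_primitive {F f : ℝ → X} (hT : 0 ≤ T)
    (hF : IntervalIntegrable F volume 0 T)
    (hf : ∀ t ∈ Set.Icc 0 T, f t = f 0 + ∫ s in (0 : ℝ)..t, F s) :
    ContinuousOn f (Set.Icc 0 T) := by
  have hc := intervalIntegral.continuousOn_primitive_interval' hF Set.left_mem_uIcc
  rw [Set.uIcc_of_le hT] at hc
  exact (continuousOn_const.add hc).congr hf

omit [NormedSpace ℝ X] [CompleteSpace X] in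
lemma intervalIntegrable_of_memLp_volT {F : ℝ → X} (hF : MemLp F 2 (volT T)) {a b : ℝ}
    (ha : a ∈ Set.Icc 0 T) (hb : b ∈ Set.Icc 0 T) : IntervalIntegrable F volume a b := by
  have h1 : IntegrableOn F (Set.Ioo 0 T) := hF.integrable (by norm_num)
  have h2 : IntegrableOn F (Set.Icc 0 T) := (integrableOn_Icc_iff_integrableOn_Ioo).2 h1
  exact (h2.mono_set (Set.uIcc_subset_Icc ha hb)).intervalIntegrable

namespace IsH2InTime

variable {u u' u'' v v' v'' : ℝ → X}

lemma intervalIntegrable (h : IsH2InTime T u u' u'') {a b : ℝ}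
    (ha : a ∈ Set.Icc 0 T) (hb : b ∈ Set.Icc 0 T) : IntervalIntegrable u'' volume a b :=
  intervalIntegrable_of_memLp_volT h.memLp ha hb

lemma continuousOn_deriv (h : IsH2InTime T u u' u'') (hT : 0 ≤ T) :
    ContinuousOn u' (Set.Icc 0 T) :=
  continuousOn_of_eq_primitive hT
    (h.intervalIntegrable (Set.left_mem_Icc.2 hT) (Set.right_mem_Icc.2 hT)) h.deriv_eq

lemma intervalIntegrable_deriv (h : IsH2InTime T u u' u'') {a b : ℝ}
    (ha : a ∈ Set.Icc 0 T) (hb : b ∈ Set.Icc 0 T) : IntervalIntegrable u' volume a b :=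
  ((h.continuousOn_deriv (ha.1.trans ha.2)).mono (Set.uIcc_subset_Icc ha hb)).intervalIntegrable

lemma continuousOn (h : IsH2InTime T u u' u'') (hT : 0 ≤ T) : ContinuousOn u (Set.Icc 0 T) :=
  continuousOn_of_eq_primitive hT
    (h.intervalIntegrable_deriv (Set.left_mem_Icc.2 hT) (Set.right_mem_Icc.2 hT)) h.primitive_eq

lemma map (h : IsH2InTime T u u' u'') (Φ : X →L[ℝ] Y) :
    IsH2InTime T (fun t => Φ (u t)) (fun t => Φ (u' t)) (fun t => Φ (u'' t)) where
  memLp := Φ.comp_memLp' h.memLp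
  deriv_eq t ht := by
    have h0 : (0 : ℝ) ∈ Set.Icc 0 T := Set.left_mem_Icc.2 (ht.1.trans ht.2)
    rw [h.deriv_eq t ht, map_add, Φ.intervalIntegral_comp_comm (h.intervalIntegrable h0 ht)]
  primitive_eq t ht := by
    have h0 : (0 : ℝ) ∈ Set.Icc 0 T := Set.left_mem_Icc.2 (ht.1.trans ht.2)
    rw [h.primitive_eq t ht, map_add,
      Φ.intervalIntegral_comp_comm (h.intervalIntegrable_deriv h0 ht)]

lemma sub (hu : IsH2InTime T u u' u'') (hv : IsH2InTime T v v' v'') :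
    IsH2InTime T (fun t => u t - v t) (fun t => u' t - v' t) (fun t => u'' t - v'' t) where
  memLp := hu.memLp.sub hv.memLp
  deriv_eq t ht := by
    have h0 : (0 : ℝ) ∈ Set.Icc 0 T := Set.left_mem_Icc.2 (ht.1.trans ht.2)
    rw [hu.deriv_eq t ht, hv.deriv_eq t ht, intervalIntegral.integral_sub
      (hu.intervalIntegrable h0 ht) (hv.intervalIntegrable h0 ht)]
    abel
  primitive_eq t ht := by
    have h0 : (0 : ℝ) ∈ Set.Icc 0 T := Set.left_mem_Icc.2 (ht.1.trans ht.2)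
    rw [hu.primitive_eq t ht, hv.primitive_eq t ht, intervalIntegral.integral_sub
      (hu.intervalIntegrable_deriv h0 ht) (hv.intervalIntegrable_deriv h0 ht)]
    abel

/-- If `u` takes values in a closed subspace, so does its time derivative. -/
lemma deriv_mem (h : IsH2InTime T u u' u'') (hT : 0 < T) (S : Submodule ℝ X)
    (hS : IsClosed (S : Set X)) (hu : ∀ t ∈ Set.Icc 0 T, u t ∈ S) :
    ∀ t ∈ Set.Icc 0 T, u' t ∈ S := by
  have hopen : ∀ t ∈ Set.Ioo 0 T, u' t ∈ S := by
    intro t ht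
    have hn : Set.Icc 0 T ∈ 𝓝 t := Icc_mem_nhds ht.1 ht.2
    have h0 : (0 : ℝ) ∈ Set.Icc 0 T := Set.left_mem_Icc.2 hT.le
    have hd : HasDerivAt (fun s => u 0 + ∫ r in (0 : ℝ)..s, u' r) (u' t) t := by
      refine (intervalIntegral.integral_hasDerivAt_right
        (h.intervalIntegrable_deriv h0 (Set.Ioo_subset_Icc_self ht)) ?_
        ((h.continuousOn_deriv hT.le).continuousAt hn)).const_add _
      exact ⟨_, hn, (h.continuousOn_deriv hT.le).aestronglyMeasurable measurableSet_Icc⟩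
    have hd' : HasDerivAt u (u' t) t := by
      refine hd.congr_of_eventuallyEq ?_
      -- At an interior time `u'` is a genuine derivative, hence a limit of difference quotients
      -- lying in `S`; the endpoints are reached afterwards by continuity of `u'`.
      filter_upwards [hn] with s hs using h.primitive_eq s hs
    refine hS.mem_of_tendsto (hasDerivAt_iff_tendsto_slope.1 hd') ?_
    filter_upwards [nhdsWithin_le_nhds hn] with s hs
    exact S.smul_mem _ (S.sub_mem (hu s hs) (hu t (Set.Ioo_subset_Icc_self ht)))
  have hcl : closure (Set.Ioo 0 T) = Set.Icc 0 T := closure_Ioo hT.ne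
  intro t ht
  have : u' t ∈ closure (S : Set X) :=
    (((h.continuousOn_deriv hT.le) t ht).mono Set.Ioo_subset_Icc_self).mem_closure
      (hcl ▸ ht) hopen
  rwa [hS.closure_eq] at this

end IsH2InTime

/-- Product rule on `[0, T]`. -/
lemma bilin_eq_of_primitive (C : X →L[ℝ] Y →L[ℝ] ℝ) {f F : ℝ → X} {g G : ℝ → Y}
    (hF : ∀ t ∈ Set.Icc 0 T, IntervalIntegrable F volume 0 t)
    (hG : ∀ t ∈ Set.Icc 0 T, IntervalIntegrable G volume 0 t)
    (hf : ∀ t ∈ Set.Icc 0 T, f t = f 0 + ∫ s in (0 : ℝ)..t, F s)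
    (hg : ∀ t ∈ Set.Icc 0 T, g t = g 0 + ∫ s in (0 : ℝ)..t, G s) :
    ∀ t ∈ Set.Icc 0 T, C (f t) (g t) =
      C (f 0) (g 0) + ∫ s in (0 : ℝ)..t, (C (F s) (g s) + C (f s) (G s)) := by
  intro t ht
  have := bilin_primitive C (hF t ht) (hG t ht) (f 0) (g 0)
  rw [hf t ht, hg t ht, this]
  congr 1
  refine intervalIntegral.integral_congr fun s hs => ?_
  rw [Set.uIcc_of_le ht.1] at hs
  have hs' : s ∈ Set.Icc 0 T := ⟨hs.1, hs.2.trans ht.2⟩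
  simp only [hf s hs', hg s hs']

end Time

/-! ### Energy estimate with integration by parts in time. -/

section Energy

variable {X Y : Type*} [NormedAddCommGroup X] [NormedSpace ℝ X]
  [NormedAddCommGroup Y] [NormedSpace ℝ Y]

lemma intervalIntegrable_bilin (C : X →L[ℝ] Y →L[ℝ] ℝ) {F : ℝ → X} {g : ℝ → Y} {a b : ℝ}
    (hF : IntervalIntegrable F volume a b) (hg : ContinuousOn g (Set.uIcc a b)) :
    IntervalIntegrable (fun s => C (F s) (g s)) volume a b := by
  obtain ⟨M, hM⟩ := isCompact_uIcc.exists_bound_of_continuousOn hg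
  have hm : AEStronglyMeasurable g (volume.restrict (Set.uIoc a b)) :=
    (hg.aestronglyMeasurable measurableSet_uIcc).mono_set Set.uIoc_subset_uIcc
  refine (hF.norm.const_mul (‖C‖ * M)).mono_fun'
    (C.aestronglyMeasurable_comp₂ (intervalIntegrable_iff.1 hF).aestronglyMeasurable hm) ?_
  filter_upwards [ae_restrict_mem measurableSet_uIoc] with s hs
  have hs' := hM s (Set.uIoc_subset_uIcc hs)
  have hM0 : 0 ≤ M := (norm_nonneg _).trans hs'
  calc ‖C (F s) (g s)‖ ≤ ‖C‖ * ‖F s‖ * ‖g s‖ := C.le_opNorm₂ _ _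
    _ ≤ ‖C‖ * ‖F s‖ * M := by gcongr
    _ = _ := by ring

variable [CompleteSpace X] [CompleteSpace Y] {T : ℝ}

/-- Energy estimate for a second order evolution equation with right-hand side
`B(R, x) + A(z, y')`, where `x` is the velocity and `y'` the time derivative of `y`. -/
theorem energy_estimate (hT : 0 ≤ T) {α β r : ℝ} (hα : 0 < α)
    (B : X →L[ℝ] X →L[ℝ] ℝ) (A : Y →L[ℝ] Y →L[ℝ] ℝ)
    (hBs : ∀ v w, B v w = B w v) (hAs : ∀ v w, A v w = A w v)
    (hBc : ∀ v, α * ‖v‖ ^ 2 ≤ B v v) (hAc : ∀ v, α * ‖v‖ ^ 2 ≤ A v v)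
    (hBb : ∀ v w, |B v w| ≤ β * ‖v‖ * ‖w‖) (hAb : ∀ v w, |A v w| ≤ β * ‖v‖ * ‖w‖)
    (hβ : 0 < β) (hr : 0 ≤ r)
    {x x' R : ℝ → X} {y y' z z' : ℝ → Y}
    (hx' : IntervalIntegrable x' volume 0 T) (hy' : IntervalIntegrable y' volume 0 T)
    (hz' : IntervalIntegrable z' volume 0 T) (hR : IntervalIntegrable R volume 0 T)
    (hx : ∀ t ∈ Set.Icc 0 T, x t = x 0 + ∫ s in (0 : ℝ)..t, x' s)
    (hy : ∀ t ∈ Set.Icc 0 T, y t = y 0 + ∫ s in (0 : ℝ)..t, y' s)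
    (hz : ∀ t ∈ Set.Icc 0 T, z t = z 0 + ∫ s in (0 : ℝ)..t, z' s)
    (heq : ∀ᵐ t ∂(volT T), B (x' t) (x t) + A (y t) (y' t) = B (R t) (x t) + A (z t) (y' t))
    (hrz : ∀ t ∈ Set.Icc 0 T, ‖z t‖ ≤ r) (hrR : ∫ s in (0 : ℝ)..T, (‖R s‖ + ‖z' s‖) ≤ r) :
    ∀ t ∈ Set.Icc 0 T,
      √(‖x t‖ ^ 2 + ‖y t‖ ^ 2) ≤ β / α * (√(‖x 0‖ ^ 2 + ‖y 0‖ ^ 2) + 6 * r) := by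
  have h0 : (0 : ℝ) ∈ Set.Icc 0 T := Set.left_mem_Icc.2 hT
  have sub : ∀ {t}, t ∈ Set.Icc 0 T → Set.uIcc 0 t ⊆ Set.uIcc 0 T := fun ht =>
    Set.uIcc_subset_uIcc_left (by rwa [Set.uIcc_of_le hT])
  have cx := continuousOn_of_eq_primitive hT hx' hx
  have cy := continuousOn_of_eq_primitive hT hy' hy
  have cz := continuousOn_of_eq_primitive hT hz' hz
  set m : ℝ → ℝ := fun t => √(‖x t‖ ^ 2 + ‖y t‖ ^ 2) with hm
  have cm : ContinuousOn m (Set.Icc 0 T) := by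
    exact ((cx.norm.pow 2).add (cy.norm.pow 2)).sqrt
  -- At a time where the energy norm is maximal, every term on the right carries a factor `m t₀`,
  -- which is cancelled at the end; no Gronwall argument is needed.
  obtain ⟨t₀, ht₀, hmax⟩ := isCompact_Icc.exists_isMaxOn ⟨0, h0⟩ cm
  have hmax' : ∀ t ∈ Set.Icc 0 T, m t ≤ m t₀ := fun t ht => hmax ht
  have hm0 : ∀ t, 0 ≤ m t := fun t => Real.sqrt_nonneg _
  have hmx : ∀ t, ‖x t‖ ≤ m t := fun t => Real.le_sqrt_of_sq_le (by nlinarith [sq_nonneg ‖y t‖])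
  have hmy : ∀ t, ‖y t‖ ≤ m t := fun t => Real.le_sqrt_of_sq_le (by nlinarith [sq_nonneg ‖x t‖])
  have hmsq : ∀ t, m t ^ 2 = ‖x t‖ ^ 2 + ‖y t‖ ^ 2 := fun t => Real.sq_sqrt (by positivity)
  refine fun t ht => (hmax' t ht).trans ?_
  -- the energy identity at `t₀`
  have ix := hx'.mono_set (sub ht₀)
  have iy := hy'.mono_set (sub ht₀)
  have iz := hz'.mono_set (sub ht₀)
  have iR := hR.mono_set (sub ht₀)
  have su : Set.uIcc 0 t₀ ⊆ Set.Icc 0 T := (sub ht₀).trans (Set.uIcc_of_le hT).subset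
  have mx := cx.mono su
  have my := cy.mono su
  have mz := cz.mono su
  have e1 := bilin_eq_of_primitive B (fun t ht => hx'.mono_set (sub ht))
    (fun t ht => hx'.mono_set (sub ht)) hx hx t₀ ht₀
  have e2 := bilin_eq_of_primitive A (fun t ht => hy'.mono_set (sub ht))
    (fun t ht => hy'.mono_set (sub ht)) hy hy t₀ ht₀
  have e3 := bilin_eq_of_primitive A (fun t ht => hz'.mono_set (sub ht))
    (fun t ht => hy'.mono_set (sub ht)) hz hy t₀ ht₀
  simp only [hBs (x _) (x' _), ← two_mul] at e1
  simp only [hAs (y _) (y' _), ← two_mul] at e2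
  simp only [hAs (z _) (y' _)] at e3
  have j1 := (intervalIntegrable_bilin B ix mx).const_mul 2
  have j2 := (intervalIntegrable_bilin A iy my).const_mul 2
  have j3 := (intervalIntegrable_bilin A iz my).add (intervalIntegrable_bilin A iy mz)
  -- The term `A (z s) (y' s)` cannot be bounded by the energy. The product rule `e3` trades it for
  -- boundary terms and `A (z' s) (y s)`.
  have key : B (x t₀) (x t₀) + A (y t₀) (y t₀) - 2 * A (z t₀) (y t₀) =
      B (x 0) (x 0) + A (y 0) (y 0) - 2 * A (z 0) (y 0) +
      ∫ s in (0 : ℝ)..t₀, (2 * B (R s) (x s) - 2 * A (z' s) (y s)) := by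
    have : ∫ s in (0 : ℝ)..t₀, (2 * B (R s) (x s) - 2 * A (z' s) (y s)) =
        ∫ s in (0 : ℝ)..t₀, (2 * B (x' s) (x s) + 2 * A (y' s) (y s)
          - 2 * (A (z' s) (y s) + A (y' s) (z s))) := by
      refine intervalIntegral.integral_congr_ae ?_
      rw [ae_restrict_iff' measurableSet_Ioo] at heq
      -- The equation holds on the open interval, whereas the interval integral runs over a
      -- half-open one that may contain `T`.
      have hne : ∀ᵐ s : ℝ, s ≠ T := by simp [ae_iff, measure_singleton]
      filter_upwards [heq, hne] with s hs hsT hmem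
      rw [Set.uIoc_of_le ht₀.1] at hmem
      have := hs ⟨hmem.1, lt_of_le_of_ne (hmem.2.trans ht₀.2) hsT⟩
      rw [hAs (y s), hAs (z s)] at this
      linarith
    rw [this, intervalIntegral.integral_sub (j1.add j2) (j3.const_mul 2),
      intervalIntegral.integral_add j1 j2,
      intervalIntegral.integral_const_mul 2 fun s => A (z' s) (y s) + A (y' s) (z s), e1, e2, e3]
    ring
  have hint : |∫ s in (0 : ℝ)..t₀, (2 * B (R s) (x s) - 2 * A (z' s) (y s))| ≤
      2 * β * m t₀ * r := by
    have iN : IntervalIntegrable (fun s => ‖R s‖ + ‖z' s‖) volume 0 T := hR.norm.add hz'.norm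
    calc |∫ s in (0 : ℝ)..t₀, (2 * B (R s) (x s) - 2 * A (z' s) (y s))|
        ≤ ∫ s in (0 : ℝ)..t₀, 2 * β * m t₀ * (‖R s‖ + ‖z' s‖) := by
          rw [← Real.norm_eq_abs]
          refine intervalIntegral.norm_integral_le_of_norm_le ht₀.1 (ae_of_all _ fun s hs => ?_)
            ((iN.mono_set (sub ht₀)).const_mul _)
          have hs' : s ∈ Set.Icc 0 T := ⟨hs.1.le, hs.2.trans ht₀.2⟩
          have k1 := hBb (R s) (x s)
          have k2 := hAb (z' s) (y s)
          have k3 : β * ‖R s‖ * ‖x s‖ ≤ β * ‖R s‖ * m t₀ := by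
            gcongr; exact (hmx s).trans (hmax' s hs')
          have k4 : β * ‖z' s‖ * ‖y s‖ ≤ β * ‖z' s‖ * m t₀ := by
            gcongr; exact (hmy s).trans (hmax' s hs')
          rw [Real.norm_eq_abs]
          refine (abs_sub _ _).trans ?_
          rw [abs_mul, abs_mul, abs_two]
          linarith
      _ = 2 * β * m t₀ * ∫ s in (0 : ℝ)..t₀, (‖R s‖ + ‖z' s‖) := by
          rw [intervalIntegral.integral_const_mul]
      _ ≤ 2 * β * m t₀ * r := by
          have := hm0 t₀
          gcongr
          refine le_trans ?_ hrR
          exact intervalIntegral.integral_mono_interval le_rfl ht₀.1 ht₀.2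
            (ae_of_all _ fun s => by positivity) iN
  have l1 : α * m t₀ ^ 2 ≤ B (x t₀) (x t₀) + A (y t₀) (y t₀) := by
    rw [hmsq, mul_add]; exact add_le_add (hBc _) (hAc _)
  have l2 : B (x 0) (x 0) + A (y 0) (y 0) ≤ β * m t₀ * m 0 := by
    have k1 := (le_abs_self _).trans (hBb (x 0) (x 0))
    have k2 := (le_abs_self _).trans (hAb (y 0) (y 0))
    have k3 : β * m 0 * m 0 ≤ β * m t₀ * m 0 := by
      have := hm0 0
      gcongr; exact hmax' 0 h0
    have := hmsq 0
    nlinarith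
  have zb : ∀ t ∈ Set.Icc 0 T, |A (z t) (y t)| ≤ β * r * m t₀ := fun t ht => by
    refine (hAb _ _).trans ?_
    gcongr
    · exact hrz t ht
    · exact (hmy t).trans (hmax' t ht)
  have z1 := (abs_le.1 (zb t₀ ht₀)).2
  have z2 := (abs_le.1 (zb 0 h0)).1
  have z3 := (abs_le.1 hint).2
  -- The constant 6 collects 2 from each boundary term of `A (z ·) (y ·)` and 2 from the integral.
  have fin : α * m t₀ ^ 2 ≤ m t₀ * (β * (m 0 + 6 * r)) := by nlinarith
  rcases (hm0 t₀).eq_or_lt with h | h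
  · rw [← h]; have := hm0 0; positivity
  · rw [div_mul_eq_mul_div, le_div_iff₀ hα]
    nlinarith

end Energy

/-! ### Abstract Galerkin error estimate and convergence. -/

section Galerkin

/-- A finite spanning set gives one null set that works for all test vectors. This permits test
vectors that vary with time. -/
lemma ae_forall_mem_of_forall_ae {ι K : Type*} [MeasurableSpace ι] {μ : Measure ι}
    [AddCommGroup K] [Module ℝ K] (S : Submodule ℝ K) [FiniteDimensional ℝ S]
    (l : ι → K →ₗ[ℝ] ℝ) (h : ∀ v ∈ S, ∀ᵐ t ∂μ, l t v = 0) : ∀ᵐ t ∂μ, ∀ v ∈ S, l t v = 0 := by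
  obtain ⟨s, hs⟩ := (Submodule.fg_iff_finiteDimensional S).2 inferInstance
  have : ∀ᵐ t ∂μ, ∀ v ∈ (s : Set K), l t v = 0 :=
    (ae_ball_iff s.countable_toSet).2 fun v hv => h v (hs ▸ Submodule.subset_span hv)
  filter_upwards [this] with t ht v hv
  have hle : Submodule.span ℝ (s : Set K) ≤ LinearMap.ker (l t) := Submodule.span_le.2 ht
  exact hle (hs ▸ hv)

variable {K X Y : Type*} [NormedAddCommGroup K] [InnerProductSpace ℝ K] [CompleteSpace K]
  [NormedAddCommGroup X] [NormedSpace ℝ X] [CompleteSpace X]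
  [NormedAddCommGroup Y] [NormedSpace ℝ Y] [CompleteSpace Y] {T : ℝ}

lemma IsH2InTime.norm_deriv_le {ρ ρ' ρ'' : ℝ → X} (h : IsH2InTime T ρ ρ' ρ'') {t : ℝ}
    (ht : t ∈ Set.Icc 0 T) : ‖ρ' t‖ ≤ ‖ρ' 0‖ + ∫ s in (0 : ℝ)..T, ‖ρ'' s‖ := by
  have h0 : (0 : ℝ) ∈ Set.Icc 0 T := Set.left_mem_Icc.2 (ht.1.trans ht.2)
  have hT : T ∈ Set.Icc 0 T := Set.right_mem_Icc.2 (ht.1.trans ht.2)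
  rw [h.deriv_eq t ht]
  refine (norm_add_le _ _).trans (add_le_add_right ?_ _)
  refine (intervalIntegral.norm_integral_le_integral_norm ht.1).trans ?_
  exact intervalIntegral.integral_mono_interval le_rfl ht.1 ht.2
    (ae_of_all _ fun s => norm_nonneg _) (h.intervalIntegrable h0 hT).norm

lemma IsH2InTime.norm_le {ρ ρ' ρ'' : ℝ → X} (h : IsH2InTime T ρ ρ' ρ'') {c : ℝ}
    (hc : ∀ t ∈ Set.Icc 0 T, ‖ρ' t‖ ≤ c) {t : ℝ} (ht : t ∈ Set.Icc 0 T) :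
    ‖ρ t‖ ≤ ‖ρ 0‖ + T * c := by
  have hc0 : 0 ≤ c := (norm_nonneg _).trans (hc t ht)
  rw [h.primitive_eq t ht]
  refine (norm_add_le _ _).trans (add_le_add_right ?_ _)
  have := intervalIntegral.norm_integral_le_of_norm_le_const (a := 0) (b := t) (f := ρ') (C := c)
    fun s hs => by
      rw [Set.uIoc_of_le ht.1] at hs
      exact hc s ⟨hs.1.le, hs.2.trans ht.2⟩
  refine this.trans ?_
  rw [sub_zero, abs_of_nonneg ht.1, mul_comm]
  exact mul_le_mul_of_nonneg_right ht.2 hc0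

/-- Error estimate of the semidiscrete solution in terms of the projection error `ρ`. -/
theorem galerkin_estimate (hT : 0 < T) {α β δ η : ℝ} (hα : 0 < α) (hβ : 0 < β)
    (p : K →L[ℝ] X) (q : K →L[ℝ] Y) (hp : ∀ x, ‖p x‖ ≤ ‖x‖) (hq : ∀ x, ‖q x‖ ≤ ‖x‖)
    (B : X →L[ℝ] X →L[ℝ] ℝ) (A : Y →L[ℝ] Y →L[ℝ] ℝ)
    (hBs : ∀ v w, B v w = B w v) (hAs : ∀ v w, A v w = A w v)
    (hBc : ∀ v, α * ‖v‖ ^ 2 ≤ B v v) (hAc : ∀ v, α * ‖v‖ ^ 2 ≤ A v v)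
    (hBb : ∀ v w, |B v w| ≤ β * ‖v‖ * ‖w‖) (hAb : ∀ v w, |A v w| ≤ β * ‖v‖ * ‖w‖)
    (S : Submodule ℝ K) [FiniteDimensional ℝ S]
    {U U' U'' V V' V'' ρ ρ' ρ'' : ℝ → K} (hU : IsH2InTime T U U' U'')
    (hV : IsH2InTime T V V' V'') (hρ : IsH2InTime T ρ ρ' ρ'')
    (hVS : ∀ t ∈ Set.Icc 0 T, V t ∈ S) (hUS : ∀ t ∈ Set.Icc 0 T, U t - ρ t ∈ S)
    (heq : ∀ v ∈ S, ∀ᵐ t ∂(volT T), B (p (V'' t - U'' t)) (p v) + A (q (V t - U t)) (q v) = 0)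
    (hδ : ‖p (V' 0 - U' 0)‖ + ‖q (V 0 - U 0)‖ ≤ δ)
    (hη : ‖ρ 0‖ + ‖ρ' 0‖ + ∫ s in (0 : ℝ)..T, ‖ρ'' s‖ ≤ η) :
    ∀ t ∈ Set.Icc 0 T,
      ‖p (V' t - U' t)‖ ≤ β / α * (δ + 8 * ((1 + T) * η)) + (1 + T) * η ∧
      ‖q (V t - U t)‖ ≤ β / α * (δ + 8 * ((1 + T) * η)) + (1 + T) * η := by
  have h0 : (0 : ℝ) ∈ Set.Icc 0 T := Set.left_mem_Icc.2 hT.le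
  have hTT : T ∈ Set.Icc 0 T := Set.right_mem_Icc.2 hT.le
  -- The discrete part of the error, `V - (U - ρ)`, stays in `S`; its derivative does too, since `S`
  -- is closed, and may be used as a test vector.
  have he := hV.sub (hU.sub hρ)
  have heS : ∀ t ∈ Set.Icc 0 T, V t - (U t - ρ t) ∈ S := fun t ht =>
    S.sub_mem (hVS t ht) (hUS t ht)
  have heS' := he.deriv_mem hT S S.closed_of_finiteDimensional heS
  have hint0 : 0 ≤ ∫ s in (0 : ℝ)..T, ‖ρ'' s‖ :=
    intervalIntegral.integral_nonneg hT.le fun _ _ => norm_nonneg _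
  have hη0 : 0 ≤ η := by linarith [norm_nonneg (ρ 0), norm_nonneg (ρ' 0)]
  have hρ' : ∀ t ∈ Set.Icc 0 T, ‖ρ' t‖ ≤ η := fun t ht => by
    linarith [hρ.norm_deriv_le ht, norm_nonneg (ρ 0)]
  have hρ0 : ∀ t ∈ Set.Icc 0 T, ‖ρ t‖ ≤ (1 + T) * η := fun t ht => by
    linarith [hρ.norm_le hρ' ht, norm_nonneg (ρ' 0)]
  have hr : 0 ≤ (1 + T) * η := by positivity
  have hTη : 0 ≤ T * η := by positivity
  -- `ρ''` contributes at most `η` and the uniform bound on `ρ'` contributes `T * η`; the same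
  -- number bounds `ρ` itself.
  have hrR : ∫ s in (0 : ℝ)..T, (‖p (ρ'' s)‖ + ‖q (ρ' s)‖) ≤ (1 + T) * η := by
    have i1 := (hρ.intervalIntegrable h0 hTT).norm
    have i2 : IntervalIntegrable (fun _ : ℝ => η) volume 0 T := intervalIntegrable_const
    calc ∫ s in (0 : ℝ)..T, (‖p (ρ'' s)‖ + ‖q (ρ' s)‖)
        ≤ ∫ s in (0 : ℝ)..T, (‖ρ'' s‖ + η) := by
          refine intervalIntegral.integral_mono_on hT.le
            (((hρ.map p).intervalIntegrable h0 hTT).norm.add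
              ((hρ.map q).intervalIntegrable_deriv h0 hTT).norm) (i1.add i2) fun s hs => ?_
          exact add_le_add (hp _) ((hq _).trans (hρ' s hs))
      _ ≤ (1 + T) * η := by
          rw [intervalIntegral.integral_add i1 i2, intervalIntegral.integral_const, sub_zero,
            smul_eq_mul]
          linarith [norm_nonneg (ρ 0), norm_nonneg (ρ' 0)]
  have hae := ae_forall_mem_of_forall_ae S
    (fun t => ((B (p (V'' t - U'' t))).comp p + (A (q (V t - U t))).comp q : K →L[ℝ] ℝ).toLinearMap)
    heq
  have hae' : ∀ᵐ t ∂(volT T),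
      B (p (V'' t - (U'' t - ρ'' t))) (p (V' t - (U' t - ρ' t))) +
        A (q (V t - (U t - ρ t))) (q (V' t - (U' t - ρ' t))) =
      B (p (ρ'' t)) (p (V' t - (U' t - ρ' t))) + A (q (ρ t)) (q (V' t - (U' t - ρ' t))) := by
    filter_upwards [hae, ae_restrict_mem measurableSet_Ioo] with t ht htm
    have := ht _ (heS' t (Set.Ioo_subset_Icc_self htm))
    rw [sub_sub_eq_add_sub, sub_sub_eq_add_sub (V t), add_sub_right_comm, add_sub_right_comm (V t),
      map_add p, map_add q, map_add B, map_add A, add_apply, add_apply]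
    change B (p (V'' t - U'' t)) (p (V' t - (U' t - ρ' t))) +
      A (q (V t - U t)) (q (V' t - (U' t - ρ' t))) = 0 at this
    linarith
  have hen := energy_estimate hT.le hα B A hBs hAs hBc hAc hBb hAb hβ hr
    ((he.map p).intervalIntegrable h0 hTT) ((he.map q).intervalIntegrable_deriv h0 hTT)
    ((hρ.map q).intervalIntegrable_deriv h0 hTT) ((hρ.map p).intervalIntegrable h0 hTT)
    (he.map p).deriv_eq (he.map q).primitive_eq (hρ.map q).primitive_eq hae'
    (fun t ht => (hq _).trans (hρ0 t ht)) hrR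
  have hinit : √(‖p (V' 0 - (U' 0 - ρ' 0))‖ ^ 2 + ‖q (V 0 - (U 0 - ρ 0))‖ ^ 2) ≤
      δ + 2 * ((1 + T) * η) := by
    have e1 : V' 0 - (U' 0 - ρ' 0) = V' 0 - U' 0 + ρ' 0 := by abel
    have e2 : V 0 - (U 0 - ρ 0) = V 0 - U 0 + ρ 0 := by abel
    have n1 : ‖p (V' 0 - (U' 0 - ρ' 0))‖ ≤ ‖p (V' 0 - U' 0)‖ + (1 + T) * η := by
      rw [e1, map_add]
      refine (norm_add_le _ _).trans (add_le_add_right ((hp _).trans ?_) _)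
      linarith [hρ' 0 h0]
    have n2 : ‖q (V 0 - (U 0 - ρ 0))‖ ≤ ‖q (V 0 - U 0)‖ + (1 + T) * η := by
      rw [e2, map_add]
      exact (norm_add_le _ _).trans (add_le_add_right ((hq _).trans (hρ0 0 h0)) _)
    have a1 := norm_nonneg (p (V' 0 - (U' 0 - ρ' 0)))
    have a2 := norm_nonneg (q (V 0 - (U 0 - ρ 0)))
    have a3 : ‖p (V' 0 - (U' 0 - ρ' 0))‖ + ‖q (V 0 - (U 0 - ρ 0))‖ ≤ δ + 2 * ((1 + T) * η) := by
      linarith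
    refine Real.sqrt_le_iff.2 ⟨(add_nonneg a1 a2).trans a3, ?_⟩
    nlinarith [pow_le_pow_left₀ (add_nonneg a1 a2) a3 2]
  intro t ht
  have hbd := (hen t ht).trans (mul_le_mul_of_nonneg_left (add_le_add_left hinit _)
    (div_pos hβ hα).le)
  -- Of the 8, 2 comes from replacing `U` by `U - ρ` in the two initial data and 6 from the energy
  -- estimate.
  rw [show δ + 2 * ((1 + T) * η) + 6 * ((1 + T) * η) = δ + 8 * ((1 + T) * η) by ring] at hbd
  have s1 : ‖p (V' t - (U' t - ρ' t))‖ ≤ β / α * (δ + 8 * ((1 + T) * η)) :=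
    (Real.le_sqrt_of_sq_le (by nlinarith [sq_nonneg ‖q (V t - (U t - ρ t))‖])).trans hbd
  have s2 : ‖q (V t - (U t - ρ t))‖ ≤ β / α * (δ + 8 * ((1 + T) * η)) :=
    (Real.le_sqrt_of_sq_le (by nlinarith [sq_nonneg ‖p (V' t - (U' t - ρ' t))‖])).trans hbd
  constructor
  · rw [show V' t - U' t = V' t - (U' t - ρ' t) - ρ' t by abel, map_sub]
    refine (norm_sub_le _ _).trans (add_le_add s1 ((hp _).trans ?_))
    linarith [hρ' t ht]
  · rw [show V t - U t = V t - (U t - ρ t) - ρ t by abel, map_sub]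
    exact (norm_sub_le _ _).trans (add_le_add s2 ((hq _).trans (hρ0 t ht)))

/-- The projection error of an `H²(0,T;K)` function on an increasing sequence of subspaces
tends to zero. -/
lemma tendsto_projection_error (hT : 0 < T) (S : ℕ → Submodule ℝ K)
    [∀ L, FiniteDimensional ℝ (S L)] (hS : Monotone S) {U U' U'' : ℝ → K}
    (hU : IsH2InTime T U U' U'') (h₀ : U 0 ∈ (⨆ L, S L).topologicalClosure)
    (h₁ : U' 0 ∈ (⨆ L, S L).topologicalClosure)
    (h₂ : ∀ t, U'' t ∈ (⨆ L, S L).topologicalClosure) :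
    Tendsto (fun L => ‖U 0 - (S L).starProjection (U 0)‖ + ‖U' 0 - (S L).starProjection (U' 0)‖ +
      ∫ s in (0 : ℝ)..T, ‖U'' s - (S L).starProjection (U'' s)‖) atTop (𝓝 0) := by
  have hlim : ∀ x ∈ (⨆ L, S L).topologicalClosure,
      Tendsto (fun L => ‖x - (S L).starProjection x‖) atTop (𝓝 0) := by
    intro x hx
    have hc : CompleteSpace (⨆ L, S L).topologicalClosure :=
      (Submodule.isClosed_topologicalClosure _).completeSpace_coe
    have := Submodule.starProjection_tendsto_closure_iSup S hS x
    -- The projections converge strongly to the projection onto the closure of the union, which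
    -- fixes `x`.
    rw [Submodule.starProjection_eq_self_iff.2 hx] at this
    simpa using ((tendsto_const_nhds (x := x)).sub this).norm
  have h0 : (0 : ℝ) ∈ Set.Icc 0 T := Set.left_mem_Icc.2 hT.le
  have hTT : T ∈ Set.Icc 0 T := Set.right_mem_Icc.2 hT.le
  have hi := hU.intervalIntegrable h0 hTT
  have hint : Tendsto (fun L => ∫ s in (0 : ℝ)..T, ‖U'' s - (S L).starProjection (U'' s)‖) atTop
      (𝓝 (∫ _ in (0 : ℝ)..T, (0 : ℝ))) := by
    refine intervalIntegral.tendsto_integral_filter_of_dominated_convergence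
      (fun s => 2 * ‖U'' s‖) (Eventually.of_forall fun L => ?_)
      (Eventually.of_forall fun L => ae_of_all _ fun s _ => ?_) (hi.norm.const_mul 2)
      (ae_of_all _ fun s _ => hlim _ (h₂ s))
    · have hm := (intervalIntegrable_iff.1 hi).aestronglyMeasurable
      exact (hm.sub ((S L).starProjection.continuous.comp_aestronglyMeasurable hm)).norm
    · rw [norm_norm, two_mul]
      exact (norm_sub_le _ _).trans (add_le_add_right ((S L).norm_starProjection_apply_le _) _)
  simpa using ((hlim _ h₀).add (hlim _ h₁)).add hint

/-- Convergence of semidiscrete approximations of an abstract second order evolution equation. -/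
theorem galerkin_convergence (hT : 0 < T) {α β : ℝ} (hα : 0 < α) (hβ : 0 < β)
    (p : K →L[ℝ] X) (q : K →L[ℝ] Y) (hp : ∀ x, ‖p x‖ ≤ ‖x‖) (hq : ∀ x, ‖q x‖ ≤ ‖x‖)
    (B : X →L[ℝ] X →L[ℝ] ℝ) (A : Y →L[ℝ] Y →L[ℝ] ℝ)
    (hBs : ∀ v w, B v w = B w v) (hAs : ∀ v w, A v w = A w v)
    (hBc : ∀ v, α * ‖v‖ ^ 2 ≤ B v v) (hAc : ∀ v, α * ‖v‖ ^ 2 ≤ A v v)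
    (hBb : ∀ v w, |B v w| ≤ β * ‖v‖ * ‖w‖) (hAb : ∀ v w, |A v w| ≤ β * ‖v‖ * ‖w‖)
    (S : ℕ → Submodule ℝ K) [∀ L, FiniteDimensional ℝ (S L)] (hS : Monotone S)
    {U U' U'' : ℝ → K} {V V' V'' : ℕ → ℝ → K} (hU : IsH2InTime T U U' U'')
    (hV : ∀ L, IsH2InTime T (V L) (V' L) (V'' L))
    (h₀ : U 0 ∈ (⨆ L, S L).topologicalClosure) (h₁ : U' 0 ∈ (⨆ L, S L).topologicalClosure)
    (h₂ : ∀ t, U'' t ∈ (⨆ L, S L).topologicalClosure)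
    (hVS : ∀ L, ∀ t ∈ Set.Icc 0 T, V L t ∈ S L)
    (heq : ∀ L, ∀ v ∈ S L, ∀ᵐ t ∂(volT T),
      B (p (V'' L t - U'' t)) (p v) + A (q (V L t - U t)) (q v) = 0)
    (hδ₁ : Tendsto (fun L => ‖p (V' L 0 - U' 0)‖) atTop (𝓝 0))
    (hδ₂ : Tendsto (fun L => ‖q (V L 0 - U 0)‖) atTop (𝓝 0)) :
    ∃ ε : ℕ → ℝ, Tendsto ε atTop (𝓝 0) ∧ ∀ L, ∀ t ∈ Set.Icc 0 T,
      ‖p (V' L t - U' t)‖ ≤ ε L ∧ ‖q (V L t - U t)‖ ≤ ε L := by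
  have hη := tendsto_projection_error hT S hS hU h₀ h₁ h₂
  -- The sequence `ε` is read off from the estimate, with `ρ` the image of `U` under the
  -- complementary projection and `δ`, `η` replaced by the quantities they bound.
  refine ⟨_, ?_, fun L => galerkin_estimate hT hα hβ p q hp hq B A hBs hAs hBc hAc hBb hAb (S L)
    hU (hV L) (hU.map (ContinuousLinearMap.id ℝ K - (S L).starProjection)) (hVS L)
    (fun t _ => ?_) (heq L) le_rfl le_rfl⟩
  · have h1 := hη.const_mul (1 + T)
    have := (((hδ₁.add hδ₂).add (h1.const_mul 8)).const_mul (β / α)).add h1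
    simpa using this
  · simp

/-- Convergence of semidiscrete approximations of a second order evolution equation whose two
bilinear forms are coercive in terms of operators `P` and `Q`. -/
theorem galerkin_convergence_of_operators {Z X Y : Type*}
    [NormedAddCommGroup Z] [NormedSpace ℝ Z] [CompleteSpace Z]
    [NormedAddCommGroup X] [InnerProductSpace ℝ X] [CompleteSpace X]
    [NormedAddCommGroup Y] [InnerProductSpace ℝ Y] [CompleteSpace Y]
    (hT : 0 < T) {α β : ℝ} (hα : 0 < α) (hβ : 0 < β) (P : Z →L[ℝ] X) (Q : Z →L[ℝ] Y)
    (B : X →L[ℝ] X →L[ℝ] ℝ) (A : Y →L[ℝ] Y →L[ℝ] ℝ)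
    (hBs : ∀ v w, B v w = B w v) (hAs : ∀ v w, A v w = A w v)
    (hBc : ∀ v, α * ‖v‖ ^ 2 ≤ B v v) (hAc : ∀ v, α * ‖v‖ ^ 2 ≤ A v v)
    (hBb : ∀ v w, |B v w| ≤ β * ‖v‖ * ‖w‖) (hAb : ∀ v w, |A v w| ≤ β * ‖v‖ * ‖w‖)
    (S : ℕ → Submodule ℝ Z) [∀ L, FiniteDimensional ℝ (S L)] (hS : Monotone S)
    (hdense : ∀ z, ∃ w : ℕ → Z, (∀ L, w L ∈ S L) ∧ Tendsto w atTop (𝓝 z))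
    {u u' u'' : ℝ → Z} {v v' v'' : ℕ → ℝ → Z} (hu : IsH2InTime T u u' u'')
    (hv : ∀ L, IsH2InTime T (v L) (v' L) (v'' L))
    (hvS : ∀ L, ∀ t ∈ Set.Icc 0 T, v L t ∈ S L)
    (heq : ∀ L, ∀ w ∈ S L, ∀ᵐ t ∂(volT T),
      B (P (v'' L t - u'' t)) (P w) + A (Q (v L t - u t)) (Q w) = 0)
    (hδ₁ : Tendsto (fun L => ‖P (v' L 0 - u' 0)‖) atTop (𝓝 0))
    (hδ₂ : Tendsto (fun L => ‖Q (v L 0 - u 0)‖) atTop (𝓝 0)) :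
    ∃ ε : ℕ → ℝ, Tendsto ε atTop (𝓝 0) ∧ ∀ L, ∀ t ∈ Set.Icc 0 T,
      ‖P (v' L t - u' t)‖ ≤ ε L ∧ ‖Q (v L t - u t)‖ ≤ ε L := by
  -- `Z` is only a Banach space, so orthogonal projections are taken in the Hilbert space `WithLp 2
  -- (X × Y)`, onto the images of the `S L`. No coercivity on `Z` is required.
  let Φ : Z →L[ℝ] WithLp 2 (X × Y) :=
    (WithLp.prodContinuousLinearEquiv 2 ℝ X Y).symm.toContinuousLinearMap.comp (P.prod Q)
  have hP : ∀ z, WithLp.fstL 2 ℝ X Y (Φ z) = P z := fun _ => rfl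
  have hQ : ∀ z, WithLp.sndL 2 ℝ X Y (Φ z) = Q z := fun _ => rfl
  have hcl : ∀ z, Φ z ∈ (⨆ L, (S L).map Φ.toLinearMap).topologicalClosure := by
    intro z
    obtain ⟨w, hw, hwl⟩ := hdense z
    exact mem_closure_of_tendsto ((Φ.continuous.tendsto z).comp hwl)
      (Eventually.of_forall fun L => (le_iSup (fun L => (S L).map Φ.toLinearMap) L)
        (Submodule.mem_map_of_mem (hw L)))
  obtain ⟨ε, hε, h⟩ := galerkin_convergence hT hα hβ (WithLp.fstL 2 ℝ X Y) (WithLp.sndL 2 ℝ X Y)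
    (fun x => WithLp.norm_fst_le _ x) (fun x => WithLp.norm_snd_le _ x) B A hBs hAs hBc hAc hBb hAb
    (fun L => (S L).map Φ.toLinearMap) (fun L L' h => Submodule.map_mono (hS h)) (hu.map Φ)
    (fun L => (hv L).map Φ) (hcl _) (hcl _) (fun t => hcl _)
    (fun L t ht => Submodule.mem_map_of_mem (hvS L t ht))
    (fun L w hw => by
      obtain ⟨w, hw, rfl⟩ := hw
      filter_upwards [heq L w hw] with t ht
      rw [← map_sub, ← map_sub, hP, hQ]
      exact ht)
    (by simpa only [← map_sub, hP] using hδ₁) (by simpa only [← map_sub, hQ] using hδ₂)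
  refine ⟨ε, hε, fun L t ht => ?_⟩
  have := h L t ht
  rwa [← map_sub, ← map_sub, hP, hQ] at this

end Galerkin

/-! ### Pull-backs to `D × 𝐘`, orthogonality of the scales, and the weighted forms. -/

section Spaces

variable {d : ℕ}

/-! ### Pull-backs along the projections of `D × 𝐘` -/

/-- The measure on `D × Y_1 × ⋯ × Y_k` is a product measure. -/
lemma volDY_eq_prod (D : BoundedDomain d) (k : ℕ) :
    volDY D k = (volD D).prod (Measure.pi fun _ : Fin k => volume.restrict (cell d)) := by
  have : prodDomain D k = D.carrier ×ˢ Set.pi Set.univ fun _ => cell d := by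
    ext p; simp [prodDomain]
  rw [volDY, this, Measure.volume_eq_prod, ← Measure.prod_restrict, volume_pi,
    Measure.restrict_pi_pi (fun _ : Fin k => (volume : Measure (E d))) fun _ => cell d]

lemma volume_cell (d : ℕ) : volume (cell d) = 1 := by
  have h : cell d = (WithLp.ofLp : E d → (Fin d → ℝ)) ⁻¹'
      Set.pi Set.univ fun _ => Set.Ioo (0 : ℝ) 1 := by
    ext y; simp [cell]
  rw [h, (PiLp.volume_preserving_ofLp (Fin d)).measure_preimage
    (MeasurableSet.univ_pi fun _ => measurableSet_Ioo).nullMeasurableSet]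
  exact (Real.volume_pi_Ioo (a := fun _ : Fin d => 0) (b := fun _ => 1)).trans (by simp)

instance (d : ℕ) : IsProbabilityMeasure (volume.restrict (cell d)) :=
  ⟨by rw [Measure.restrict_apply_univ, volume_cell]⟩

/-- The preimage of a box is a box with full factors in the forgotten coordinates, and these have
measure one because `μ` is a probability measure. -/
lemma measurePreserving_pi_comp {ι κ Z : Type*} [Fintype ι] [Fintype κ] [MeasurableSpace Z]
    (μ : Measure Z) [IsProbabilityMeasure μ] {f : κ → ι} (hf : f.Injective) :
    MeasurePreserving (fun (y : ι → Z) j => y (f j)) (Measure.pi fun _ => μ)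
      (Measure.pi fun _ => μ) := by
  have hm : Measurable fun (y : ι → Z) (j : κ) => y (f j) := by fun_prop
  refine ⟨hm, (Measure.pi_eq fun s hs => ?_).symm⟩
  rw [Measure.map_apply hm (MeasurableSet.univ_pi hs)]
  have : (fun (y : ι → Z) j => y (f j)) ⁻¹' Set.pi Set.univ s =
      Set.pi Set.univ (Function.extend f s fun _ => Set.univ) := by
    ext y
    simp only [Set.mem_preimage, Set.mem_univ_pi]
    refine ⟨fun h i => ?_, fun h j => by simpa [hf.extend_apply] using h (f j)⟩
    by_cases hi : ∃ j, f j = i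
    · obtain ⟨j, rfl⟩ := hi
      rw [hf.extend_apply]; exact h j
    · rw [Function.extend_apply' _ _ _ hi]; trivial
  rw [this, Measure.pi_pi]
  symm
  refine Fintype.prod_of_injective f hf _ _ (fun i hi => ?_) fun j => by rw [hf.extend_apply]
  rw [Function.extend_apply' _ _ _ (by simpa using hi), measure_univ]

/-- Selection of some of the variables `y_j`. -/
def sel {k n : ℕ} (f : Fin k → Fin n) (p : Pt d n) : Pt d k := (p.1, fun j => p.2 (f j))

lemma measurePreserving_sel (D : BoundedDomain d) {k n : ℕ} {f : Fin k → Fin n}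
    (hf : f.Injective) : MeasurePreserving (sel f) (volDY D n) (volDY D k) := by
  rw [volDY_eq_prod, volDY_eq_prod]
  exact (MeasurePreserving.id _).prod (measurePreserving_pi_comp _ hf)

lemma measurePreserving_fst (D : BoundedDomain d) (n : ℕ) :
    MeasurePreserving (Prod.fst : Pt d n → E d) (volDY D n) (volD D) := by
  rw [volDY_eq_prod]
  exact MeasureTheory.measurePreserving_fst

variable {D : BoundedDomain d} {m k l n : ℕ}

/-- Functions of some of the variables `y_j` as functions of all of them. -/
noncomputable def pull (f : Fin k ↪ Fin n) : L2DY D k m →ₗᵢ[ℝ] L2DY D n m :=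
  Lp.compMeasurePreservingₗᵢ ℝ (sel f) (measurePreserving_sel D f.injective)

/-- Functions of `x` as functions on `D × 𝐘`. -/
noncomputable def pull₀ : Lp (E m) 2 (volD D) →ₗᵢ[ℝ] L2DY D n m :=
  Lp.compMeasurePreservingₗᵢ ℝ Prod.fst (measurePreserving_fst D n)

lemma coeFn_pull (f : Fin k ↪ Fin n) (F : L2DY D k m) :
    pull f F =ᵐ[volDY D n] fun p => F (sel f p) :=
  Lp.coeFn_compMeasurePreserving F (measurePreserving_sel D f.injective)

lemma coeFn_pull₀ (F : Lp (E m) 2 (volD D)) :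
    (pull₀ F : L2DY D n m) =ᵐ[volDY D n] fun p => F p.1 :=
  Lp.coeFn_compMeasurePreserving F (measurePreserving_fst D n)

lemma pull_pull (f : Fin k ↪ Fin l) (g : Fin l ↪ Fin n) (F : L2DY D k m) :
    pull g (pull f F) = pull (f.trans g) F := by
  refine Lp.ext ?_
  filter_upwards [coeFn_pull g (pull f F), coeFn_pull (f.trans g) F,
    (measurePreserving_sel D g.injective).quasiMeasurePreserving.ae (coeFn_pull f F)]
    with p h1 h2 h3
  rw [h1, h2, h3]; rfl

lemma pull_pull₀ (g : Fin l ↪ Fin n) (F : Lp (E m) 2 (volD D)) :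
    pull g (pull₀ F) = pull₀ F := by
  refine Lp.ext ?_
  filter_upwards [coeFn_pull g (pull₀ F), coeFn_pull₀ (n := n) F,
    (measurePreserving_sel D g.injective).quasiMeasurePreserving.ae (coeFn_pull₀ (n := l) F)]
    with p h1 h2 h3
  rw [h1, h2, h3]; rfl

/-! ### Functions of vanishing mean in the last variable -/

/-- The mean over `Y_{k+1}` vanishes, for almost every value of the other variables. -/
def MeanZero (g : L2DY D (k + 1) m) : Prop :=
  ∀ ψ : Pt d k → ℝ, IsParamTest ψ → ∀ c : Fin m, ∫ p, ψ (front p) * g p c ∂(volDY D (k + 1)) = 0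

/-- For `h` an indicator times a constant vector, the indicator is itself an admissible parameter
test function, so the mean-zero condition applies. Linearity and density of simple functions do the
rest. -/
lemma inner_pull_castSucc_eq_zero {g : L2DY D (k + 1) m} (hg : MeanZero g) (h : L2DY D k m) :
    inner ℝ (pull Fin.castSuccEmb h) g = 0 := by
  induction h using Lp.induction (by norm_num : (2 : ℝ≥0∞) ≠ ⊤) with
  | @indicatorConst c s hs hμ =>
    set ψ : Pt d k → ℝ := s.indicator 1 with hψdef
    have hψ : IsParamTest ψ := by
      refine ⟨measurable_one.indicator hs, 1, fun z => ?_⟩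
      by_cases hz : z ∈ s <;> simp [hψdef, hz]
    have hmem : MemLp (fun p : Pt d (k + 1) => ψ (front p)) 2 (volDY D (k + 1)) := by
      simpa using memLp_test (D := D) hψ (φ := fun _ => 1) continuous_const
    have hi : ∀ j : Fin m, Integrable (fun p => ψ (front p) * g p j) (volDY D (k + 1)) := fun j =>
      hmem.integrable_mul ((EuclideanSpace.proj (𝕜 := ℝ) j).comp_memLp' (Lp.memLp g))
    rw [L2.inner_def]
    have : ∫ p, inner ℝ ((pull Fin.castSuccEmb
          (Lp.simpleFunc.indicatorConst 2 hs hμ.ne c : L2DY D k m) : L2DY D (k + 1) m) p) (g p)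
        ∂(volDY D (k + 1)) = ∫ p, ∑ j, c j * (ψ (front p) * g p j) ∂(volDY D (k + 1)) := by
      refine integral_congr_ae ?_
      have h1 : (Lp.simpleFunc.indicatorConst 2 hs hμ.ne c : L2DY D k m) =ᵐ[volDY D k]
          s.indicator fun _ => c := by
        rw [Lp.simpleFunc.coe_indicatorConst]; exact indicatorConstLp_coeFn
      filter_upwards [coeFn_pull Fin.castSuccEmb
        (Lp.simpleFunc.indicatorConst 2 hs hμ.ne c : L2DY D k m),
        (measurePreserving_sel D
          Fin.castSuccEmb.injective).quasiMeasurePreserving.ae h1] with p h2 h3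
      rw [h2, h3, show sel Fin.castSuccEmb p = front p from rfl]
      by_cases hz : front p ∈ s
      · simp [hψdef, hz, PiLp.inner_apply, mul_comm]
      · simp [hψdef, hz]
    rw [this, integral_finsetSum _ fun j _ => (hi j).const_mul _]
    simp [integral_const_mul, hg ψ hψ]
  | add hf hg' _ h1 h2 => rw [map_add, inner_add_left, h1, h2, add_zero]
  | isClosed =>
    exact isClosed_eq ((pull (D := D) (m := m) Fin.castSuccEmb).continuous.inner
      continuous_const) continuous_const

/-- The embedding of `{1, …, i+1}` into `{1, …, n}`. -/
def initEmb (i : Fin n) : Fin (i + 1) ↪ Fin n := Fin.castLEEmb i.isLt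

lemma inner_pull_pull_of_lt {i j : Fin n} (hij : i < j) (F : L2DY D (i + 1) m)
    {G : L2DY D (j + 1) m} (hG : MeanZero G) :
    inner ℝ (pull (initEmb i) F) (pull (initEmb j) G) = 0 := by
  have hij' : (i : ℕ) + 1 ≤ j := hij
  -- Indices are zero-based: `G` depends on `j + 1` fast variables, and `F` on at most the first
  -- `j`, so `F` does not involve the one over which `G` has zero mean.
  have : initEmb i = ((Fin.castLEEmb hij').trans Fin.castSuccEmb).trans
      (initEmb j) := by
    ext x; rfl
  rw [this, ← pull_pull, LinearIsometry.inner_map_map, ← pull_pull,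
    inner_pull_castSucc_eq_zero hG]

lemma inner_pull₀_pull (F : Lp (E m) 2 (volD D)) {j : Fin n} {G : L2DY D (j + 1) m}
    (hG : MeanZero G) : inner ℝ (pull₀ F) (pull (initEmb j) G) = 0 := by
  rw [← pull_pull₀ (initEmb j), LinearIsometry.inner_map_map,
    ← pull_pull₀ Fin.castSuccEmb, inner_pull_castSucc_eq_zero hG]

/-- `F(x) + ∑_i G_i(x, y_1, …, y_i)` as an element of `L²(D × 𝐘)`. -/
noncomputable def multiscale : (Lp (E m) 2 (volD D) × ∀ i : Fin n, L2DY D (i + 1) m) →L[ℝ] L2DY D n m :=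
  pull₀.toContinuousLinearMap.comp (ContinuousLinearMap.fst ℝ _ _) +
    ∑ i, ((pull (initEmb i)).toContinuousLinearMap.comp (ContinuousLinearMap.proj i)).comp
      (ContinuousLinearMap.snd ℝ _ _)

lemma multiscale_apply (F : Lp (E m) 2 (volD D)) (G : ∀ i : Fin n, L2DY D (i + 1) m) :
    multiscale (F, G) = pull₀ F + ∑ i, pull (initEmb i) (G i) := by
  simp [multiscale]

lemma coeFn_multiscale (F : Lp (E m) 2 (volD D)) (G : ∀ i : Fin n, L2DY D (i + 1) m) :
    multiscale (F, G) =ᵐ[volDY D n] fun p => F p.1 + ∑ i, G i (upTo i p) := by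
  rw [multiscale_apply]
  have h : ∀ᵐ p ∂(volDY D n), ∀ i, (pull (initEmb i) (G i) : L2DY D n m) p = G i (upTo i p) :=
    ae_all_iff.2 fun i => coeFn_pull (initEmb i) (G i)
  filter_upwards [Lp.coeFn_add (pull₀ F) (∑ i, pull (initEmb i) (G i)), coeFn_pull₀ (n := n) F,
    Lp.coeFn_fun_finsetSum (Finset.univ) fun i => pull (initEmb i) (G i), h] with p h1 h2 h3 h4
  rw [h1, Pi.add_apply, h2, h3]
  simp only [h4]

/-- Pythagoras: the terms are pairwise orthogonal after pull-back, and each pull-back is an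
isometry. -/
lemma norm_sq_multiscale (F : Lp (E m) 2 (volD D)) {G : ∀ i : Fin n, L2DY D (i + 1) m}
    (hG : ∀ i, MeanZero (G i)) :
    ‖multiscale (F, G)‖ ^ 2 = ‖F‖ ^ 2 + ∑ i, ‖G i‖ ^ 2 := by
  have h0 : inner ℝ (pull₀ F) (∑ i, pull (initEmb i) (G i)) = 0 := by
    rw [inner_sum]
    exact Finset.sum_eq_zero fun i _ => inner_pull₀_pull F (hG i)
  have hij : ∀ i j, i ≠ j → inner ℝ (pull (initEmb i) (G i)) (pull (initEmb j) (G j)) = 0 := by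
    intro i j hne
    rcases lt_or_gt_of_ne hne with h | h
    · exact inner_pull_pull_of_lt h _ (hG j)
    · rw [real_inner_comm]; exact inner_pull_pull_of_lt h _ (hG i)
  rw [multiscale_apply, norm_add_sq_real, h0, mul_zero, add_zero, LinearIsometry.norm_map]
  congr 1
  rw [← real_inner_self_eq_norm_sq, sum_inner]
  refine Finset.sum_congr rfl fun i _ => ?_
  rw [inner_sum, Finset.sum_eq_single i (fun j _ h => hij i j h.symm) (by simp),
    real_inner_self_eq_norm_sq, LinearIsometry.norm_map]

lemma norm_macro_le_multiscale (F : Lp (E m) 2 (volD D)) {G : ∀ i : Fin n, L2DY D (i + 1) m}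
    (hG : ∀ i, MeanZero (G i)) : ‖F‖ ≤ ‖multiscale (F, G)‖ := by
  refine (sq_le_sq₀ (norm_nonneg _) (norm_nonneg _)).1 ?_
  rw [norm_sq_multiscale F hG]
  exact le_add_of_nonneg_right (Finset.sum_nonneg fun _ _ => sq_nonneg _)

lemma norm_scale_le_multiscale (F : Lp (E m) 2 (volD D)) {G : ∀ i : Fin n, L2DY D (i + 1) m}
    (hG : ∀ i, MeanZero (G i)) (i : Fin n) : ‖G i‖ ≤ ‖multiscale (F, G)‖ := by
  refine (sq_le_sq₀ (norm_nonneg _) (norm_nonneg _)).1 ?_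
  rw [norm_sq_multiscale F hG]
  have := Finset.single_le_sum (f := fun i => ‖G i‖ ^ 2) (fun _ _ => sq_nonneg _)
    (Finset.mem_univ i)
  exact this.trans (le_add_of_nonneg_left (sq_nonneg _))

/-! ### The bilinear forms on `L²(D × 𝐘)` -/

lemma mform_add_left (M : Matrix (Fin m) (Fin m) ℝ) (ξ ξ' ζ : E m) :
    mform M (ξ + ξ') ζ = mform M ξ ζ + mform M ξ' ζ := by
  simp [mform, mul_add, add_mul, Finset.sum_add_distrib]

lemma mform_smul_left (M : Matrix (Fin m) (Fin m) ℝ) (c : ℝ) (ξ ζ : E m) :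
    mform M (c • ξ) ζ = c * mform M ξ ζ := by
  simp only [mform, PiLp.smul_apply, smul_eq_mul, Finset.mul_sum]
  exact Finset.sum_congr rfl fun i _ => Finset.sum_congr rfl fun j _ => by ring

lemma mform_comm {M : Matrix (Fin m) (Fin m) ℝ} (hM : M.IsSymm) (ξ ζ : E m) :
    mform M ξ ζ = mform M ζ ξ := by
  rw [mform, Finset.sum_comm]
  refine Finset.sum_congr rfl fun i _ => Finset.sum_congr rfl fun j _ => ?_
  rw [hM.apply]; ring

lemma weighted_congr {M : Pt d n → Matrix (Fin m) (Fin m) ℝ} {F F' G G' : Pt d n → E m}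
    (hF : F =ᵐ[volDY D n] F') (hG : G =ᵐ[volDY D n] G') :
    weighted D M F G = weighted D M F' G' :=
  integral_congr_ae (by filter_upwards [hF, hG] with p h1 h2; rw [h1, h2])

namespace IsCoefficient

variable {α β : ℝ} {M : Pt d n → Matrix (Fin m) (Fin m) ℝ}

lemma abs_mform_le (hM : IsCoefficient D α β M) {p : Pt d n} (hp : p ∈ prodDomain D n)
    (ξ ζ : E m) : |mform (M p) ξ ζ| ≤ β * ‖ξ‖ * ‖ζ‖ := by
  refine abs_le.2 ⟨?_, hM.bounded p hp ξ ζ⟩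
  -- The coefficient bound is one-sided; applied to `-ξ` it gives the lower bound.
  have := hM.bounded p hp ((-1 : ℝ) • ξ) ζ
  rw [mform_smul_left, norm_smul, norm_neg, norm_one] at this
  linarith

lemma ae_mem (D : BoundedDomain d) (n : ℕ) : ∀ᵐ p ∂(volDY D n), p ∈ prodDomain D n :=
  ae_restrict_mem (measurableSet_prodDomain D n)

lemma integrable_norm_mul (F G : L2DY D n m) :
    Integrable (fun p => ‖F p‖ * ‖G p‖) (volDY D n) :=
  (Lp.memLp F).norm.integrable_mul (Lp.memLp G).norm

lemma integral_norm_mul_le (F G : L2DY D n m) :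
    ∫ p, ‖F p‖ * ‖G p‖ ∂(volDY D n) ≤ ‖F‖ * ‖G‖ := by
  have h := real_inner_le_norm ((Lp.memLp F).norm.toLp _) ((Lp.memLp G).norm.toLp _)
  have hn : ∀ H : L2DY D n m, ‖(Lp.memLp H).norm.toLp _‖ = ‖H‖ := fun H => by
    rw [Lp.norm_toLp, eLpNorm_norm]; rfl
  rw [hn, hn, L2.inner_def] at h
  refine le_of_eq_of_le (integral_congr_ae ?_) h
  filter_upwards [(Lp.memLp F).norm.coeFn_toLp, (Lp.memLp G).norm.coeFn_toLp] with p h1 h2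
  rw [h1, h2]
  simp [mul_comm]

lemma integrable_mform (hM : IsCoefficient D α β M) (F G : L2DY D n m) :
    Integrable (fun p => mform (M p) (F p) (G p)) (volDY D n) := by
  refine ((integrable_norm_mul F G).const_mul β).mono' ?_ ?_
  · have hc : ∀ (H : L2DY D n m) (i : Fin m), AEMeasurable (fun p => H p i) (volDY D n) :=
      fun H i => ((EuclideanSpace.proj (𝕜 := ℝ) i : E m →L[ℝ] ℝ).continuous.comp_aestronglyMeasurable
        (Lp.aestronglyMeasurable H)).aemeasurable
    refine AEMeasurable.aestronglyMeasurable ?_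
    unfold mform
    exact Finset.aemeasurable_fun_sum _ fun i _ => Finset.aemeasurable_fun_sum _ fun j _ =>
      ((hM.measurable i j).mul (hc F i)).mul (hc G j)
  · filter_upwards [ae_mem D n] with p hp
    rw [← mul_assoc]
    exact hM.abs_mform_le hp _ _

lemma abs_weighted_le (hM : IsCoefficient D α β M) (hβ : 0 ≤ β) (F G : L2DY D n m) :
    |weighted D M F G| ≤ β * ‖F‖ * ‖G‖ := by
  have h1 : |weighted D M F G| ≤ ∫ p, β * (‖F p‖ * ‖G p‖) ∂(volDY D n) := by
    rw [← Real.norm_eq_abs]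
    refine norm_integral_le_of_norm_le ((integrable_norm_mul F G).const_mul β) ?_
    filter_upwards [ae_mem D n] with p hp
    rw [← mul_assoc]
    exact hM.abs_mform_le hp _ _
  rw [integral_const_mul] at h1
  rw [mul_assoc]
  exact h1.trans (mul_le_mul_of_nonneg_left (integral_norm_mul_le F G) hβ)

lemma weighted_comm (hM : IsCoefficient D α β M) (F G : Pt d n → E m) :
    weighted D M F G = weighted D M G F :=
  integral_congr_ae (by
    filter_upwards [ae_mem D n] with p hp using mform_comm (hM.symm p hp) _ _)

lemma weighted_add_left (hM : IsCoefficient D α β M) (F F' G : L2DY D n m) :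
    weighted D M ↑(F + F') G = weighted D M F G + weighted D M F' G := by
  rw [weighted, weighted, weighted, ← integral_add (hM.integrable_mform F G)
    (hM.integrable_mform F' G)]
  refine integral_congr_ae ?_
  filter_upwards [Lp.coeFn_add F F'] with p hp
  rw [hp, Pi.add_apply, mform_add_left]

lemma weighted_smul_left (c : ℝ) (F G : L2DY D n m) :
    weighted D M ↑(c • F) G = c * weighted D M F G := by
  rw [weighted, weighted, ← integral_const_mul]
  refine integral_congr_ae ?_
  filter_upwards [Lp.coeFn_smul c F] with p hp
  rw [hp, Pi.smul_apply, mform_smul_left]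

/-- The bounded bilinear form `(F, G) ↦ ∫_D ∫_𝐘 M F · G dy dx` on `L²(D × 𝐘)`. -/
noncomputable def form (hM : IsCoefficient D α β M) (hβ : 0 ≤ β) :
    L2DY D n m →L[ℝ] L2DY D n m →L[ℝ] ℝ :=
  LinearMap.mkContinuous₂ (LinearMap.mk₂ ℝ (fun F G : L2DY D n m => weighted D M F G)
    hM.weighted_add_left (fun c F G => weighted_smul_left c F G)
    (fun F G G' => by
      rw [hM.weighted_comm, hM.weighted_add_left, hM.weighted_comm G, hM.weighted_comm G'])
    (fun c F G => by
      rw [hM.weighted_comm, weighted_smul_left, hM.weighted_comm G]; rfl)) β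
    fun F G => hM.abs_weighted_le hβ F G

lemma form_apply (hM : IsCoefficient D α β M) (hβ : 0 ≤ β) (F G : L2DY D n m) :
    hM.form hβ F G = weighted D M F G := rfl

lemma form_comm (hM : IsCoefficient D α β M) (hβ : 0 ≤ β) (F G : L2DY D n m) :
    hM.form hβ F G = hM.form hβ G F := hM.weighted_comm F G

lemma form_coercive (hM : IsCoefficient D α β M) (hβ : 0 ≤ β) (F : L2DY D n m) :
    α * ‖F‖ ^ 2 ≤ hM.form hβ F F := by
  rw [form_apply, ← real_inner_self_eq_norm_sq, L2.inner_def, ← integral_const_mul]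
  simp only [real_inner_self_eq_norm_sq]
  refine integral_mono_ae ?_ (hM.integrable_mform F F) ?_
  · have := (integrable_norm_mul F F).const_mul α
    simpa only [← sq] using this
  · filter_upwards [ae_mem D n] with p hp using hM.coercive p hp _

end IsCoefficient

end Spaces

/-! ### The total field and total curl as bounded operators. -/

section Operators

variable {d : ℕ} {D : BoundedDomain d} {k n : ℕ}

lemma isPeriodicTest_one : IsPeriodicTest (fun _ : E d => (1 : ℝ)) :=
  ⟨contDiff_const, fun _ _ => rfl⟩

lemma pd_one (j : Fin d) (y : E d) : pd j (fun _ => (1 : ℝ)) y = 0 := by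
  simp [pd]

/-- The constant function 1 is periodic with zero derivatives, so testing with it leaves only the
mean. -/
lemma IsWeakCurlY.meanZero {w : L2DY D (k + 1) d} {c : L2DY D (k + 1) (curlDim d)}
    (h : IsWeakCurlY w c) : MeanZero c := by
  intro ψ hψ m
  simpa [pd_one] using h ψ _ hψ isPeriodicTest_one m

lemma IsWeakGradY.meanZero {v : Lp ℝ 2 (volDY D (k + 1))} {g : L2DY D (k + 1) d}
    (h : IsWeakGradY v g) : MeanZero g := by
  intro ψ hψ m
  simpa [pd_one] using h ψ _ hψ isPeriodicTest_one m

lemma meanZero_curlY (w : WPer D k) : MeanZero (curlY w) := by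
  obtain ⟨w, rfl⟩ := Submodule.Quotient.mk_surjective (curlFree D k) w
  exact IsWeakCurlY.meanZero w.2

lemma meanZero_gradY (v : VPer D k) : MeanZero (gradY v) := by
  obtain ⟨v, rfl⟩ := Submodule.Quotient.mk_surjective (constY D k) v
  exact IsWeakGradY.meanZero v.2

/-- The quotient norm is an infimum of graph norms over representatives, all with the same curl, and
each graph norm dominates the norm of the curl. -/
lemma norm_curlY_le (w : WPer D k) : ‖curlY w‖ ≤ 1 * ‖w‖ := by
  rw [one_mul]
  refine le_of_forall_pos_lt_add fun ε hε => ?_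
  obtain ⟨w', rfl, hw⟩ := Submodule.Quotient.norm_mk_lt (S := curlFree D k) w hε
  exact (WithLp.norm_snd_le (p := 2) _ w'.1).trans_lt hw

lemma norm_gradY_le (v : VPer D k) : ‖gradY v‖ ≤ 1 * ‖v‖ := by
  rw [one_mul]
  refine le_of_forall_pos_lt_add fun ε hε => ?_
  obtain ⟨v', rfl, hv⟩ := Submodule.Quotient.norm_mk_lt (S := constY D k) v hε
  exact (WithLp.norm_snd_le (p := 2) _ v'.1).trans_lt hv

/-- The continuous operator `v ↦ v_0 + ∑_i ∇_{y_i} 𝔳_i`. -/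
noncomputable def fieldL : VSpace D n →L[ℝ] L2DY D n d :=
  multiscale.comp <|
    (((WithLp.fstL 2 ℝ _ _).comp (H0curl D).subtypeL).comp (ContinuousLinearMap.fst ℝ _ _)).prod <|
    (ContinuousLinearMap.pi fun i : Fin n =>
      ((gradY (D := D) (k := i)).mkContinuous 1 norm_gradY_le).comp (ContinuousLinearMap.proj i)).comp
    ((ContinuousLinearMap.snd ℝ _ _).comp (ContinuousLinearMap.snd ℝ _ _))

/-- The continuous operator `v ↦ curl v_0 + ∑_i curl_{y_i} v_i`. -/
noncomputable def curlL : VSpace D n →L[ℝ] L2DY D n (curlDim d) :=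
  multiscale.comp <|
    (((WithLp.sndL 2 ℝ _ _).comp (H0curl D).subtypeL).comp (ContinuousLinearMap.fst ℝ _ _)).prod <|
    (ContinuousLinearMap.pi fun i : Fin n =>
      ((curlY (D := D) (k := i)).mkContinuous 1 norm_curlY_le).comp (ContinuousLinearMap.proj i)).comp
    ((ContinuousLinearMap.fst ℝ _ _).comp (ContinuousLinearMap.snd ℝ _ _))

lemma fieldL_apply (v : VSpace D n) :
    fieldL v = multiscale (incl v.macro₀, fun i => gradY (v.gradPart i)) := rfl

lemma curlL_apply (v : VSpace D n) :
    curlL v = multiscale (curlX v.macro₀, fun i => curlY (v.curlPart i)) := rfl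

lemma coeFn_fieldL (v : VSpace D n) : fieldL v =ᵐ[volDY D n] totalField v :=
  coeFn_multiscale _ _

lemma coeFn_curlL (v : VSpace D n) : curlL v =ᵐ[volDY D n] totalCurl v :=
  coeFn_multiscale _ _

lemma norm_incl_le_fieldL (v : VSpace D n) : ‖incl v.macro₀‖ ≤ ‖fieldL v‖ :=
  norm_macro_le_multiscale _ fun _ => meanZero_gradY _

lemma norm_gradY_le_fieldL (v : VSpace D n) (i : Fin n) : ‖gradY (v.gradPart i)‖ ≤ ‖fieldL v‖ :=
  norm_scale_le_multiscale _ (G := fun i => gradY (v.gradPart i)) (fun _ => meanZero_gradY _) i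

lemma norm_curlX_le_curlL (v : VSpace D n) : ‖curlX v.macro₀‖ ≤ ‖curlL v‖ :=
  norm_macro_le_multiscale _ fun _ => meanZero_curlY _

lemma norm_curlY_le_curlL (v : VSpace D n) (i : Fin n) : ‖curlY (v.curlPart i)‖ ≤ ‖curlL v‖ :=
  norm_scale_le_multiscale _ (G := fun i => curlY (v.curlPart i)) (fun _ => meanZero_curlY _) i

variable {α β : ℝ} {a : Pt d n → Matrix (Fin (curlDim d)) (Fin (curlDim d)) ℝ}
  {b : Pt d n → Matrix (Fin d) (Fin d) ℝ}

lemma formA_eq (ha : IsCoefficient D α β a) (hβ : 0 ≤ β) (v w : VSpace D n) :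
    formA a v w = ha.form hβ (curlL v) (curlL w) :=
  (weighted_congr (coeFn_curlL v) (coeFn_curlL w)).symm

lemma formB_eq (hb : IsCoefficient D α β b) (hβ : 0 ≤ β) (v w : VSpace D n) :
    formB b v w = hb.form hβ (fieldL v) (fieldL w) :=
  (weighted_congr (coeFn_fieldL v) (coeFn_fieldL w)).symm

end Operators

/-! ### Hierarchies of subspaces -/

section Hierarchy

/-- Near-minimizers of the distance to `S L`, with slack `1 / (L + 1)`, converge, since nestedness
and density drive the distances to zero. -/
lemma IsApproximatingHierarchy.exists_tendsto {X : Type*} [NormedAddCommGroup X]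
    [NormedSpace ℝ X] {S : ℕ → Submodule ℝ X} (hS : IsApproximatingHierarchy S) (x : X) :
    ∃ y : ℕ → X, (∀ L, y L ∈ S L) ∧ Tendsto y atTop (𝓝 x) := by
  have h : ∀ L : ℕ, ∃ y ∈ (S L : Set X),
      dist x y < Metric.infDist x (S L) + 1 / ((L : ℝ) + 1) := fun L =>
    (Metric.infDist_lt_iff ⟨0, (S L).zero_mem⟩).1 (lt_add_of_pos_right _ (by positivity))
  choose y hy hd using h
  refine ⟨y, hy, Metric.tendsto_atTop.2 fun ε hε => ?_⟩
  obtain ⟨z, hz, hxz⟩ := Metric.mem_closure_iff.1 (hS.dense x) (ε / 2) (half_pos hε)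
  obtain ⟨N, hN⟩ := Set.mem_iUnion.1 hz
  obtain ⟨N', hN'⟩ := exists_nat_one_div_lt (half_pos hε)
  refine ⟨max N N', fun L hL => ?_⟩
  have h1 : Metric.infDist x (S L) ≤ dist x z :=
    Metric.infDist_le_dist_of_mem (hS.nested ((le_max_left _ _).trans hL) hN)
  have h2 : 1 / ((L : ℝ) + 1) ≤ 1 / ((N' : ℝ) + 1) :=
    Nat.one_div_le_one_div ((le_max_right _ _).trans hL)
  rw [dist_comm]
  linarith [hd L]

variable {d n : ℕ} {D : BoundedDomain d} {S₀ : ℕ → Submodule ℝ (WSpace D)}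
  {S : ∀ i : Fin n, ℕ → Submodule ℝ (WPer D i)} {R : ∀ i : Fin n, ℕ → Submodule ℝ (VPer D i)}

lemma mem_productSubspace {S₀ : Submodule ℝ (WSpace D)} {S : ∀ i : Fin n, Submodule ℝ (WPer D i)}
    {R : ∀ i : Fin n, Submodule ℝ (VPer D i)} {v : VSpace D n} :
    v ∈ productSubspace S₀ S R ↔
      v.macro₀ ∈ S₀ ∧ (∀ i, v.curlPart i ∈ S i) ∧ ∀ i, v.gradPart i ∈ R i := by
  simp [productSubspace, Submodule.mem_prod, Submodule.mem_pi, VSpace.macro₀, VSpace.curlPart,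
    VSpace.gradPart]

lemma finiteDimensional_productSubspace {S₀ : Submodule ℝ (WSpace D)}
    {S : ∀ i : Fin n, Submodule ℝ (WPer D i)} {R : ∀ i : Fin n, Submodule ℝ (VPer D i)}
    (h₀ : FiniteDimensional ℝ S₀) (hS : ∀ i, FiniteDimensional ℝ (S i))
    (hR : ∀ i, FiniteDimensional ℝ (R i)) :
    FiniteDimensional ℝ (productSubspace S₀ S R) := by
  rw [← Submodule.fg_iff_finiteDimensional]
  exact ((Submodule.fg_iff_finiteDimensional _).2 h₀).prod
    ((Submodule.fg_pi fun i => (Submodule.fg_iff_finiteDimensional _).2 (hS i)).prod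
      (Submodule.fg_pi fun i => (Submodule.fg_iff_finiteDimensional _).2 (hR i)))

lemma monotone_productSubspace (h₀ : Monotone S₀) (hS : ∀ i, Monotone (S i))
    (hR : ∀ i, Monotone (R i)) :
    Monotone fun L => productSubspace (S₀ L) (fun i => S i L) (fun i => R i L) := by
  intro L L' hL v hv
  rw [mem_productSubspace] at hv ⊢
  exact ⟨h₀ hL hv.1, fun i => hS i hL (hv.2.1 i), fun i => hR i hL (hv.2.2 i)⟩

lemma exists_tendsto_productSubspace (h₀ : IsApproximatingHierarchy S₀)
    (hS : ∀ i, IsApproximatingHierarchy (S i)) (hR : ∀ i, IsApproximatingHierarchy (R i))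
    (v : VSpace D n) :
    ∃ w : ℕ → VSpace D n,
      (∀ L, w L ∈ productSubspace (S₀ L) (fun i => S i L) (fun i => R i L)) ∧
      Tendsto w atTop (𝓝 v) := by
  obtain ⟨x, hx, hxl⟩ := h₀.exists_tendsto v.macro₀
  choose y hy hyl using fun i => (hS i).exists_tendsto (v.curlPart i)
  choose z hz hzl using fun i => (hR i).exists_tendsto (v.gradPart i)
  refine ⟨fun L => (x L, fun i => y i L, fun i => z i L), fun L => mem_productSubspace.2
    ⟨hx L, fun i => hy i L, fun i => hz i L⟩, ?_⟩
  exact hxl.prodMk_nhds ((tendsto_pi_nhds.2 hyl).prodMk_nhds (tendsto_pi_nhds.2 hzl))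

end Hierarchy

/-! ### Identification and convergence of the initial data. -/

section InitialData

variable {d n : ℕ} {D : BoundedDomain d} {α β T : ℝ}
  {a : Pt d n → Matrix (Fin (curlDim d)) (Fin (curlDim d)) ℝ}
  {b : Pt d n → Matrix (Fin d) (Fin d) ℝ} {f : ℝ → HSpace D}

/-- The purely microscopic curl components satisfy a stationary problem at the initial time. -/
lemma formA_init_eq_zero (ha : IsCoefficient D α β a) (hb : IsCoefficient D α β b) (hβ : 0 ≤ β)
    (hT : 0 < T) {u u' u'' : ℝ → VSpace D n} (hreg : IsH2InTime T u u' u'') {v : VSpace D n}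
    (heq : ∀ᵐ t ∂(volT T), formB b (u'' t) v + formA a (u t) v = inner ℝ (f t) (incl v.macro₀))
    (hv₀ : v.macro₀ = 0) (hv : ∀ i, v.gradPart i = 0) : formA a (u 0) v = 0 := by
  have hf : fieldL v = 0 := by
    have : incl (0 : WSpace D) = 0 := rfl
    rw [fieldL_apply, hv₀, this]
    simp only [hv, map_zero]
    exact map_zero _
  have hc : ContinuousOn (fun t => formA a (u t) v) (Set.Icc 0 T) := by
    simp only [formA_eq ha hβ]
    exact (((ha.form hβ).flip (curlL v)).comp curlL).continuous.comp_continuousOn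
      (hreg.continuousOn hT.le)
  have hae : (fun t => formA a (u t) v) =ᵐ[volume.restrict (Set.Icc 0 T)] fun _ => 0 := by
    rw [← restrict_Ioo_eq_restrict_Icc]
    filter_upwards [heq] with t ht
    have h0 : incl (0 : WSpace D) = 0 := rfl
    rwa [formB_eq hb hβ, hf, map_zero, zero_add, hv₀, h0, inner_zero_right] at ht
  -- Two continuous functions that agree almost everywhere on the interval agree at its left
  -- endpoint.
  exact Measure.eqOn_Icc_of_ae_eq volume hT.ne hae hc continuousOn_const (Set.left_mem_Icc.2 hT.le)

/-- The total field of an element with vanishing microscopic gradients. -/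
lemma fieldL_eq_pull₀ {v : VSpace D n} (hv : ∀ i, gradY (v.gradPart i) = 0) :
    fieldL v = pull₀ (incl v.macro₀) := by
  rw [fieldL_apply, multiscale_apply]
  simp [hv]

/-- The initial velocity of the homogenized problem is `g₁`. -/
lemma fieldL_init_deriv (hα : 0 < α) (hβ : 0 ≤ β) (hb : IsCoefficient D α β b) {v₁ : VSpace D n}
    {g₁ : HSpace D} (hv₁ : ∀ v : VSpace D n,
      formB b v₁ v = weighted D b (fun p => g₁ p.1) (totalField v))
    {g : ℕ → WSpace D} (hg : Tendsto (fun L => ‖incl (g L) - g₁‖) atTop (𝓝 0)) :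
    fieldL v₁ = pull₀ g₁ := by
  set w : L2DY D n d := fieldL v₁ - pull₀ g₁ with hw
  have horth : ∀ v : VSpace D n, hb.form hβ w (fieldL v) = 0 := by
    intro v
    rw [hw, map_sub, sub_apply, sub_eq_zero, ← formB_eq, hv₁, hb.form_apply]
    exact (weighted_congr (coeFn_pull₀ g₁) (coeFn_fieldL v)).symm
  -- Although `w` need not be a total field, it is the limit of the total fields of `z L`, to which
  -- it is b-orthogonal; hence `w` is b-orthogonal to itself.
  let z : ℕ → VSpace D n := fun L => v₁ - (g L, 0, 0)
  have hz : ∀ L, fieldL (z L) = fieldL v₁ - pull₀ (incl (g L)) := by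
    intro L
    rw [map_sub, fieldL_eq_pull₀ (v := ((g L, 0, 0) : VSpace D n)) fun i => map_zero gradY]
    rfl
  have hlim : Tendsto (fun L => fieldL (z L)) atTop (𝓝 w) := by
    simp only [hz, hw]
    refine tendsto_const_nhds.sub ((pull₀ (D := D) (m := d) (n := n)).continuous.tendsto g₁ |>.comp ?_)
    exact tendsto_iff_norm_sub_tendsto_zero.2 hg
  have hww : hb.form hβ w w = 0 := by
    have := ((hb.form hβ w).continuous.tendsto w).comp hlim
    refine tendsto_nhds_unique this ?_
    simp only [Function.comp_def, horth]
    exact tendsto_const_nhds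
  have := hb.form_coercive hβ w
  rw [hww] at this
  have h0 : ‖w‖ ^ 2 ≤ 0 := by nlinarith [sq_nonneg ‖w‖]
  have : ‖w‖ = 0 := by nlinarith [norm_nonneg w]
  exact sub_eq_zero.1 (norm_eq_zero.1 this)

/-- Convergence of the initial curls. -/
lemma tendsto_curlL_init (hα : 0 < α) (hβ : 0 ≤ β) (hT : 0 < T)
    (ha : IsCoefficient D α β a) (hb : IsCoefficient D α β b) {g₀ : WSpace D} {g₁ : HSpace D}
    {u u' u'' : ℝ → VSpace D n} (hreg : IsH2InTime T u u' u'')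
    (hu : IsHomogenizedSolution T a b f g₀ g₁ u u' u'')
    {S₀ : ℕ → Submodule ℝ (WSpace D)} {S : ∀ i : Fin n, ℕ → Submodule ℝ (WPer D i)}
    {R : ∀ i : Fin n, ℕ → Submodule ℝ (VPer D i)} (hS : ∀ i, IsApproximatingHierarchy (S i))
    {g₀L g₁L : ℕ → WSpace D} (hg₀ : Tendsto (fun L => ‖g₀L L - g₀‖) atTop (𝓝 0))
    {uL uL' uL'' : ℕ → ℝ → VSpace D n}
    (huL : ∀ L, IsSemidiscreteSolution T a b f (g₀L L) (g₁L L)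
      (productSubspace (S₀ L) (fun i => S i L) (fun i => R i L)) (uL L) (uL' L) (uL'' L)) :
    Tendsto (fun L => ‖curlL (uL L 0 - u 0)‖) atTop (𝓝 0) := by
  choose w hw hwl using fun i => (hS i).exists_tendsto ((u 0).curlPart i)
  -- The initial error has the total curl of `s L + z L`: `s L` is a discrete test vector with only
  -- microscopic curl components, and `z L` tends to zero. Gradient parts can be dropped because
  -- `curlL` ignores them.
  let s : ℕ → VSpace D n := fun L => (0, fun i => (uL L 0).curlPart i - w i L, 0)
  let z : ℕ → VSpace D n := fun L => (g₀L L - g₀, fun i => w i L - (u 0).curlPart i, 0)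
  have hs : ∀ L, s L ∈ productSubspace (S₀ L) (fun i => S i L) (fun i => R i L) := fun L => by
    have := mem_productSubspace.1 ((huL L).mem 0 (Set.left_mem_Icc.2 hT.le))
    exact mem_productSubspace.2 ⟨Submodule.zero_mem _,
      fun i => Submodule.sub_mem _ (this.2.1 i) (hw i L), fun i => Submodule.zero_mem _⟩
  have hsz : ∀ L, curlL (uL L 0 - u 0) - curlL (s L) = curlL (z L) := by
    intro L
    rw [← map_sub, curlL_apply, curlL_apply]
    have h1 : (uL L 0 - u 0 - s L).macro₀ = (z L).macro₀ := by
      change (uL L 0).macro₀ - (u 0).macro₀ - 0 = g₀L L - g₀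
      obtain ⟨-, hu₀, -, -⟩ := hu
      obtain ⟨-, -, -, huL₀, -, -, -⟩ := huL L
      rw [huL₀, hu₀, sub_zero]
    have h2 : ∀ i, (uL L 0 - u 0 - s L).curlPart i = (z L).curlPart i := by
      intro i
      change (uL L 0).curlPart i - (u 0).curlPart i - ((uL L 0).curlPart i - w i L) =
        w i L - (u 0).curlPart i
      abel
    rw [h1]
    simp only [h2]
  have horth : ∀ L, ha.form hβ (curlL (uL L 0 - u 0)) (curlL (s L)) = 0 := by
    intro L
    have h1 := formA_init_eq_zero ha hb hβ hT (huL L).regular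
      ((huL L).equation (s L) (hs L)) rfl fun i => rfl
    have h2 := formA_init_eq_zero ha hb hβ hT hreg (hu.equation (s L)) rfl fun i => rfl
    rw [formA_eq ha hβ] at h1 h2
    rw [map_sub, map_sub, sub_apply, h1, h2, sub_zero]
  have hz : Tendsto z atTop (𝓝 0) := by
    refine Tendsto.prodMk_nhds ?_ (Tendsto.prodMk_nhds (tendsto_pi_nhds.2 fun i => ?_)
      tendsto_const_nhds)
    · exact tendsto_zero_iff_norm_tendsto_zero.2 hg₀
    · have := (hwl i).sub (tendsto_const_nhds (x := (u 0).curlPart i))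
      rwa [sub_self] at this
  -- Céa's argument: orthogonality to `s L` replaces one copy of the error by `z L` in the
  -- coercivity inequality.
  have hle : ∀ L, ‖curlL (uL L 0 - u 0)‖ ≤ β / α * ‖curlL (z L)‖ := by
    intro L
    have h1 := ha.form_coercive hβ (curlL (uL L 0 - u 0))
    have h2 := (le_abs_self _).trans
      (ha.abs_weighted_le hβ (curlL (uL L 0 - u 0)) (curlL (z L)))
    rw [← ha.form_apply hβ, ← hsz, map_sub, horth, sub_zero, hsz] at h2
    rcases (norm_nonneg (curlL (uL L 0 - u 0))).eq_or_lt with h | h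
    · rw [← h]; positivity
    · rw [div_mul_eq_mul_div, le_div_iff₀ hα]
      nlinarith
  refine squeeze_zero (fun L => norm_nonneg _) hle ?_
  have := ((curlL (D := D) (n := n)).continuous.tendsto 0).comp hz
  rw [map_zero] at this
  simpa using this.norm.const_mul (β / α)

end InitialData

end MaxwellWave

open MaxwellWave

theorem mainTheorem9 {d : ℕ} (hd : d = 2 ∨ d = 3) (n : ℕ) (D : BoundedDomain d)
    (α β T : ℝ) (hα : 0 < α) (hβ : 0 < β) (hT : 0 < T)
    -- the coefficients
    (a : Pt d n → Matrix (Fin (curlDim d)) (Fin (curlDim d)) ℝ) (ha : IsCoefficient D α β a)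
    (b : Pt d n → Matrix (Fin d) (Fin d) ℝ) (hb : IsCoefficient D α β b)
    -- the data
    (f : ℝ → HSpace D) (hf : MemLp f 2 (volT T)) (g₀ : WSpace D) (g₁ : HSpace D)
    -- the solution of the multiscale homogenized problem, with `∂²u/∂t² ∈ L²(0,T;𝐕)`
    (u u' u'' : ℝ → VSpace D n) (hreg : IsH2InTime T u u' u'')
    (hu : IsHomogenizedSolution T a b f g₀ g₁ u u' u'')
    -- the hierarchies of finite-dimensional subspaces
    (S₀ : ℕ → Submodule ℝ (WSpace D)) (hS₀ : IsApproximatingHierarchy S₀)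
    (S : ∀ i : Fin n, ℕ → Submodule ℝ (WPer D i)) (hS : ∀ i, IsApproximatingHierarchy (S i))
    (R : ∀ i : Fin n, ℕ → Submodule ℝ (VPer D i)) (hR : ∀ i, IsApproximatingHierarchy (R i))
    -- the approximate initial data
    (g₀L g₁L : ℕ → WSpace D) (hg₀L : ∀ L, g₀L L ∈ S₀ L) (hg₁L : ∀ L, g₁L L ∈ S₀ L)
    (hg₀ : Tendsto (fun L => ‖g₀L L - g₀‖) atTop (𝓝 0))
    (hg₁ : Tendsto (fun L => ‖incl (g₁L L) - g₁‖) atTop (𝓝 0))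
    -- the semidiscrete solutions
    (uL uL' uL'' : ℕ → ℝ → VSpace D n)
    (huL : ∀ L, IsSemidiscreteSolution T a b f (g₀L L) (g₁L L)
      (productSubspace (S₀ L) (fun i => S i L) (fun i => R i L)) (uL L) (uL' L) (uL'' L)) :
    Tendsto (fun L =>
      eLpNorm (fun t => incl (uL' L t - u' t).macro₀) ⊤ (volT T)
      + ∑ i, eLpNorm (fun t => gradY ((uL' L t - u' t).gradPart i)) ⊤ (volT T)
      + eLpNorm (fun t => curlX (uL L t - u t).macro₀) ⊤ (volT T)
      + ∑ i, eLpNorm (fun t => curlY ((uL L t - u t).curlPart i)) ⊤ (volT T))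
      atTop (𝓝 0) := by
  have hfin : ∀ L, FiniteDimensional ℝ (productSubspace (S₀ L) (fun i => S i L) fun i => R i L) :=
    fun L => finiteDimensional_productSubspace (hS₀.finite L) (fun i => (hS i).finite L)
      fun i => (hR i).finite L
  -- Both initial velocity fields are pull-backs of functions of x alone, and the pull-back is
  -- isometric, so this is exactly the assumed convergence of the initial velocities in H.
  have hδ₁ : Tendsto (fun L => ‖fieldL (uL' L 0 - u' 0)‖) atTop (𝓝 0) := by
    refine hg₁.congr fun L => ?_
    obtain ⟨-, -, -, -, -, huL₁, huL₂⟩ := huL L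
    rw [map_sub, fieldL_init_deriv hα hβ.le hb hu.init_deriv hg₁,
      fieldL_eq_pull₀ huL₂, huL₁, ← map_sub,
      LinearIsometry.norm_map]
  obtain ⟨ε, hε, hbound⟩ := galerkin_convergence_of_operators hT hα hβ fieldL curlL
    (hb.form hβ.le) (ha.form hβ.le) (hb.form_comm hβ.le) (ha.form_comm hβ.le)
    (hb.form_coercive hβ.le) (ha.form_coercive hβ.le) (hb.abs_weighted_le hβ.le)
    (ha.abs_weighted_le hβ.le) (fun L => productSubspace (S₀ L) (fun i => S i L) fun i => R i L)
    (monotone_productSubspace hS₀.nested (fun i => (hS i).nested) fun i => (hR i).nested)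
    (exists_tendsto_productSubspace hS₀ hS hR) hreg (fun L => (huL L).regular)
    (fun L => (huL L).mem)
    -- Discrete test functions are admissible in the continuous problem, so subtraction eliminates
    -- f.
    (fun L v hv => by
      filter_upwards [(huL L).equation v hv, hu.equation v] with t h1 h2
      rw [formB_eq hb hβ.le, formA_eq ha hβ.le] at h1 h2
      rw [map_sub fieldL, map_sub curlL, map_sub, map_sub, sub_apply, sub_apply]
      linarith)
    hδ₁ (tendsto_curlL_init hα hβ.le hT ha hb hreg hu hS hg₀ huL)
  have hnorm : ∀ {X : Type} [NormedAddCommGroup X] (F : ℝ → X) (L : ℕ),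
      (∀ t ∈ Set.Icc 0 T, ‖F t‖ ≤ ε L) → eLpNorm F ⊤ (volT T) ≤ ENNReal.ofReal (ε L) := by
    intro X _ F L h
    rw [eLpNorm_exponent_top]
    refine eLpNormEssSup_le_of_ae_bound ?_
    filter_upwards [ae_restrict_mem measurableSet_Ioo] with t ht
    exact h t (Set.Ioo_subset_Icc_self ht)
  have hε' : Tendsto (fun L => ENNReal.ofReal (ε L)) atTop (𝓝 0) := by
    simpa using ENNReal.tendsto_ofReal hε
  have hsum : Tendsto (fun L => ENNReal.ofReal (ε L) + ∑ _i : Fin n, ENNReal.ofReal (ε L)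
      + ENNReal.ofReal (ε L) + ∑ _i : Fin n, ENNReal.ofReal (ε L)) atTop (𝓝 0) := by
    have h := tendsto_finsetSum (Finset.univ : Finset (Fin n)) fun _ _ => hε'
    simpa using ((hε'.add h).add hε').add h
  refine tendsto_of_tendsto_of_tendsto_of_le_of_le tendsto_const_nhds hsum (fun _ => zero_le)
    fun L => ?_
  refine add_le_add (add_le_add (add_le_add ?_ (Finset.sum_le_sum fun i _ => ?_)) ?_)
    (Finset.sum_le_sum fun i _ => ?_)
  · exact hnorm _ L fun t ht => (norm_incl_le_fieldL _).trans (hbound L t ht).1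
  · exact hnorm _ L fun t ht => (norm_gradY_le_fieldL _ i).trans (hbound L t ht).1
  · exact hnorm _ L fun t ht => (norm_curlX_le_curlL _).trans (hbound L t ht).2
  · exact hnorm _ L fun t ht => (norm_curlY_le_curlL _ i).trans (hbound L t ht).2
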